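/- Let $d\ge 2$ be an integer, $\lambda\in[0,1]$ and $\gamma>0$. Work in the Poincaré ball model of $d$-dimensional hyperbolic space, i.e. the open unit ball $\mathbb{B}^d\subset\mathbb{R}^d$ with centre $o=0$ and distance $\mathrm{d}_{\mathrm P}$ given by $\cosh \mathrm{d}_{\mathrm P}(x,y)=1+\frac{2\|x-y\|^2}{(1-\|x\|^2)(1-\|y\|^2)}$. For $r\in(0,1)$ and $u\in\mathbb{S}^{d-1}$ let $H(r,u)$ be the $\lambda$-geodesic hyperplane $$H(r,u)=\{y\in\mathbb{B}^d:\ \|y-(r+R)u\|=R\},\qquad R=\frac{1-r^2}{2(\lambda+r)},$$ that is, the part in $\mathbb{B}^d$ of the sphere that has Euclidean distance $r$ from $o$ in direction $u$, does not enclose $o$, and meets $\mathbb{S}^{d-1}$ at the angle $\arccos\lambda$. For $u\in\mathbb{S}^{d-1}$ and $h\in(0,1)$ let $\mathcal{S}^\circ(u,h)=\{x\in\mathbb{S}^{d-1}:\langle x,u\rangle>h\}$ and $\mathcal{S}(u,h)=\{x\in\mathbb{S}^{d-1}:\langle x,u\rangle\ge h\}$, and put $$\varphi(r)=\frac{2\sqrt{r(\lambda+r)(1+\lambda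 r)}}{1+2\lambda r+r^2},\qquad f(r)=\frac{2\gamma(1+2\lambda r+r^2)^{d-1}}{(1-r^2)^d}\quad(0<r<1),\qquad \gamma_{\mathrm{crit}}=\sqrt{\pi}\,(d-1)^2\,\frac{\Gamma(\frac{d-1}{2})}{\Gamma(\frac d2)}.$$ Let $u_1,u_2,\dots$ be independent and uniformly distributed on $\mathbb{S}^{d-1}$, let $0<r_1<r_2<\dots<1$ be random variables that form an inhomogeneous Poisson point process on $(0,1)$ with intensity function $f$, and assume that the sequences $(u_n)_{n\ge1}$ and $(r_n)_{n\ge1}$ are independent. Let $$Z=\{x\in\mathbb{B}^d:\ [o,x]\cap H(r_n,u_n)=\varnothing\ \text{ for all } n\ge 1\}$$ be the visibility set, where $[o,x]$ is the geodesic segment from $o$ to $x$ (the Euclidean segment). Boundedness of $Z$ is understood with respect to $\mathrm{d}_{\mathrm P}$. a) If $\gamma>\gamma_{\mathrm{crit}}$, then $\mathbb{P}\big[\limsup_{n\to\infty}\mathcal{S}^\circ(u_n,\varphi(r_n))=\mathbb{S}^{d-1}\big]=1$, i.e. almost surely every point of the sphere lies in infinitely many of the open caps, and $Z$ is almost surely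 bounded. b) If $\gamma<\gamma_{\mathrm{crit}}$, then $\mathbb{P}\big[\limsup_{n\to\infty}\mathcal{S}^\circ(u_n,\varphi(r_n))=\mathbb{S}^{d-1}\big]=0$ and $\mathbb{P}\big[\bigcup_{n=1}^\infty\mathcal{S}(u_n,\varphi(r_n))\ne\mathbb{S}^{d-1}\big]>0$, and $Z$ is unbounded with strictly positive probability. -/

import Mathlib

open MeasureTheory ProbabilityTheory Filter Set

noncomputable section

/-- Number of indices `n` with `X n ω ∈ B`: the value at `B` of the counting measure `∑ₙ δ_{X n ω}`. -/
def pointCount {Ω E : Type*} (X : ℕ → Ω → E) (B : Set E) (ω : Ω) : ℕ∞ :=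
  Set.encard {n : ℕ | X n ω ∈ B}

/-- The random points `X 0, X 1, …` form a Poisson point process with intensity measure `μ`:
the number of points in a measurable set `B` is Poisson distributed with parameter `μ B`
(almost surely infinite if `μ B = ∞`), and the numbers of points in pairwise disjoint measurable
sets are independent. -/
structure IsPoissonPointProcess {Ω E : Type*} [MeasurableSpace Ω] [MeasurableSpace E]
    (X : ℕ → Ω → E) (μ : Measure E) (P : Measure Ω) : Prop where
  measurable : ∀ n, Measurable (X n)
  count_law : ∀ B : Set E, MeasurableSet B → μ B ≠ ⊤ →
    HasLaw (pointCount X B) ((poissonMeasure (μ B).toNNReal).map (Nat.cast : ℕ → ℕ∞)) P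
  count_top : ∀ B : Set E, MeasurableSet B → μ B = ⊤ → ∀ᵐ ω ∂P, pointCount X B ω = ⊤
  count_indep : ∀ (m : ℕ) (B : Fin m → Set E), (∀ i, MeasurableSet (B i)) →
    Pairwise (Function.onFun Disjoint B) → iIndepFun (fun i => pointCount X (B i)) P

/-- The unit sphere of `ℝ^d`. -/
abbrev USphere (d : ℕ) : Type := Metric.sphere (0 : EuclideanSpace ℝ (Fin d)) 1

/-- The normalised surface measure on the unit sphere of `ℝ^d`, that is, the uniform distribution. -/
def uniformSphere (d : ℕ) : Measure (USphere d) :=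
  ((volume : Measure (EuclideanSpace ℝ (Fin d))).toSphere univ)⁻¹ •
    (volume : Measure (EuclideanSpace ℝ (Fin d))).toSphere

/-- The open spherical cap `{x : ⟨x, u⟩ > h}`. -/
def openCap {d : ℕ} (u : USphere d) (h : ℝ) : Set (USphere d) :=
  {x | h < inner ℝ (x : EuclideanSpace ℝ (Fin d)) (u : EuclideanSpace ℝ (Fin d))}

/-- The closed spherical cap `{x : ⟨x, u⟩ ≥ h}`. -/
def closedCap {d : ℕ} (u : USphere d) (h : ℝ) : Set (USphere d) :=
  {x | h ≤ inner ℝ (x : EuclideanSpace ℝ (Fin d)) (u : EuclideanSpace ℝ (Fin d))}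

/-- The height `φ(r)` of the shadow cap. -/
def shadowHeight (lam r : ℝ) : ℝ :=
  2 * √(r * (lam + r) * (1 + lam * r)) / (1 + 2 * lam * r + r ^ 2)

/-- The intensity function `f` of the distances `r n`. -/
def radialDensity (d : ℕ) (lam γ r : ℝ) : ℝ :=
  2 * γ * (1 + 2 * lam * r + r ^ 2) ^ (d - 1) / (1 - r ^ 2) ^ d

/-- The measure on `(0, 1)` with density `f`, as a measure on `ℝ`. -/
def radialIntensity (d : ℕ) (lam γ : ℝ) : Measure ℝ :=
  (volume.restrict (Ioo (0 : ℝ) 1)).withDensity fun r => ENNReal.ofReal (radialDensity d lam γ r)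

/-- The critical intensity `√π (d-1)² Γ((d-1)/2) / Γ(d/2)`. -/
def gammaCrit (d : ℕ) : ℝ :=
  √Real.pi * ((d : ℝ) - 1) ^ 2 * Real.Gamma (((d : ℝ) - 1) / 2) / Real.Gamma ((d : ℝ) / 2)

/-- Euclidean radius of a sphere at Euclidean distance `r` from `0` (with `0` outside) that meets
the unit sphere at an angle with cosine `lam`; see `lambdaSphere_angle`. -/
def lambdaRadius (lam r : ℝ) : ℝ := (1 - r ^ 2) / (2 * (lam + r))

/-- The Euclidean sphere that carries the `lam`-geodesic hyperplane `H(r, u)`. -/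
def lambdaSphere {d : ℕ} (lam r : ℝ) (u : USphere d) : Set (EuclideanSpace ℝ (Fin d)) :=
  Metric.sphere ((r + lambdaRadius lam r) • (u : EuclideanSpace ℝ (Fin d))) (lambdaRadius lam r)

/-- `lambdaSphere lam r u` meets the unit sphere at the angle `arccos lam` (the angle between the
outer normals of the two spheres at each common point). -/
theorem lambdaSphere_angle {d : ℕ} {lam r : ℝ} (hlam : 0 ≤ lam) (hr : r ∈ Ioo (0 : ℝ) 1)
    (u : USphere d) (p : EuclideanSpace ℝ (Fin d)) (hp : ‖p‖ = 1) (hS : p ∈ lambdaSphere lam r u) :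
    InnerProductGeometry.angle p
      (p - (r + lambdaRadius lam r) • (u : EuclideanSpace ℝ (Fin d))) = Real.arccos lam := by
  obtain ⟨h0, h1⟩ := hr
  have hu : ‖(u : EuclideanSpace ℝ (Fin d))‖ = 1 := by simp
  set R := lambdaRadius lam r with hR
  have hRe : 2 * R * (lam + r) = 1 - r ^ 2 := by
    rw [hR, lambdaRadius]; field_simp
  have hRpos : 0 < R := by
    rw [hR, lambdaRadius]; apply div_pos <;> nlinarith
  set c := (r + R) • (u : EuclideanSpace ℝ (Fin d)) with hc
  have hS' : ‖p - c‖ = R := by simpa [lambdaSphere, dist_eq_norm] using hS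
  have hcn : ‖c‖ = r + R := by
    rw [hc, norm_smul, hu, Real.norm_of_nonneg (by linarith), mul_one]
  have h2 := norm_sub_sq_real p (p - c)
  rw [sub_sub_cancel, hcn, hS', hp] at h2
  have h3 : inner ℝ p (p - c) = lam * R := by nlinarith
  rw [InnerProductGeometry.angle, h3, hS', hp]
  congr 1
  field_simp

/-- The `lam`-geodesic hyperplane `H(r, u)` in the Poincaré ball model: it lies at Euclidean
distance `r` from the centre `0`, in the direction `u`, with `0` not on its convex side. -/
def lambdaHyperplane {d : ℕ} (lam r : ℝ) (u : USphere d) : Set (EuclideanSpace ℝ (Fin d)) :=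
  lambdaSphere lam r u ∩ Metric.ball 0 1

/-- Hyperbolic distance in the Poincaré ball model (for points of the open unit ball). -/
def poincareDist {d : ℕ} (x y : EuclideanSpace ℝ (Fin d)) : ℝ :=
  Real.arcosh (1 + 2 * ‖x - y‖ ^ 2 / ((1 - ‖x‖ ^ 2) * (1 - ‖y‖ ^ 2)))

/-- The points of hyperbolic space that are visible from the centre `o = 0` of the ball in the
presence of the family `η` of obstacles. The geodesics through the centre of the ball are the
diameters, so the geodesic segment `[o, x]` is the Euclidean segment. -/
def visibilitySet {d : ℕ} (η : Set (Set (EuclideanSpace ℝ (Fin d)))) :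
    Set (EuclideanSpace ℝ (Fin d)) :=
  {x | x ∈ Metric.ball (0 : EuclideanSpace ℝ (Fin d)) 1 ∧ ∀ H ∈ η, segment ℝ 0 x ∩ H = ∅}

/-- Boundedness for the hyperbolic distance. -/
def HypBounded {d : ℕ} (Z : Set (EuclideanSpace ℝ (Fin d))) : Prop :=
  ∃ C : ℝ, ∀ x ∈ Z, poincareDist 0 x ≤ C

end

noncomputable section

open scoped ENNReal NNReal Topology Pointwise RealInnerProductSpace

/-! ### Volume of spherical caps -/

/-! A hyperplane blocks the ray from the centre in direction `v` when `v` lies in its open shadow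
cap, and misses it when `v` lies outside the closed cap (`exists_norm_lt_of_mem_openCap`,
`segment_inter_eq_empty`). By compactness of the sphere, visibility becomes a question about
covering the sphere by random caps.

In chord distance a shadow cap is a ball of radius `capRadius`, asymptotic to (1 - r)/(1 + λ). Its
measure is about `capConst` times the (d-1)st power of that radius. Multiplied by the density, which
grows like γ(1 + λ)^(d-1)/(1 - r)^d, this gives the rate γ·`capConst`/(1 - r) at which caps hit a
fixed point (`tendsto_radialDensity_mul_capMeasure`). Hence a point survives all caps with distance
in (a, b) with probability about ((1 - b)/(1 - a))^(γ·`capConst`). At scale 1 - b the sphere has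
about (1 - b)^(-(d-1)) distinguishable points, so the threshold is γ·`capConst` = d - 1, that is γ =
`gammaCrit` (`gammaCrit_mul_capConst`).

Above the threshold a first moment argument works. If a point is missed by the true caps, then a
whole ε-ball is missed by slightly shrunken caps, and Markov's inequality gives a bound that
vanishes with ε (`IsCapProcess.measure_uncovered_nonempty_mul_le`,
`IsCapProcess.measure_uncovered_eq_zero`).

Below the threshold a second moment argument works. Survival of x and y is correlated only through
caps containing both, by a factor of order dist(x, y)^(-α) with α < d - 1. This is integrable on the
sphere (`exists_riesz_bound`), so Cauchy-Schwarz bounds the survival probability from below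
uniformly in the truncation, and compactness produces an uncovered point
(`IsCapProcess.exists_subcritical`). If only caps beyond a are used, the bound tends to 1 as a tends
to 1, which excludes infinite covering. If the finite-mass part up to a is required to be empty, a
positive probability remains.

Both moments are void probabilities of a marked Poisson process
(`IsPoissonPointProcess.measure_forall_notMem`), obtained from the Laplace functional of the radii.
-/

instance uniformSphere_isProbabilityMeasure (d : ℕ) [NeZero d] :
    IsProbabilityMeasure (uniformSphere d) := by
  constructor
  rw [uniformSphere, Measure.smul_apply, smul_eq_mul]
  refine ENNReal.inv_mul_cancel ?_ (measure_ne_top _ _)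
  rw [Measure.measure_univ_ne_zero]
  exact Measure.toSphere_ne_zero _

theorem uniformSphere_apply {d : ℕ} [NeZero d] {A : Set (USphere d)} (hA : MeasurableSet A) :
    uniformSphere d A = volume (Ioo (0 : ℝ) 1 • ((↑) '' A : Set (EuclideanSpace ℝ (Fin d)))) /
      volume (Metric.ball (0 : EuclideanSpace ℝ (Fin d)) 1) := by
  rw [uniformSphere, Measure.smul_apply, smul_eq_mul, Measure.toSphere_apply_univ,
    Measure.toSphere_apply' _ hA, finrank_euclideanSpace, Fintype.card_fin, mul_comm,
    ← div_eq_mul_inv, ENNReal.mul_div_mul_left]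
  · simpa using NeZero.ne d
  · simp

/-- Any isometry can be corrected by the reflection that exchanges two vectors of equal norm. This
moves the centre of a cap to the first axis, where volumes can be computed by slicing, and shows
that they do not depend on the centre. -/
theorem exists_linearIsometryEquiv_prod {n : ℕ} (x : EuclideanSpace ℝ (Fin (n + 1)))
    (hx : ‖x‖ = 1) :
    ∃ L : EuclideanSpace ℝ (Fin (n + 1)) ≃ₗᵢ[ℝ] WithLp 2 (ℝ × EuclideanSpace ℝ (Fin n)),
      L x = WithLp.toLp 2 (1, 0) := by
  have hfr : Module.finrank ℝ (WithLp 2 (ℝ × EuclideanSpace ℝ (Fin n))) = n + 1 := by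
    rw [(WithLp.linearEquiv 2 ℝ (ℝ × EuclideanSpace ℝ (Fin n))).finrank_eq, Module.finrank_prod]
    simp [add_comm]
  let b := stdOrthonormalBasis ℝ (WithLp 2 (ℝ × EuclideanSpace ℝ (Fin n)))
  let L₀ := ((EuclideanSpace.basisFun (Fin (n + 1)) ℝ).equiv b (finCongr hfr.symm))
  let e : WithLp 2 (ℝ × EuclideanSpace ℝ (Fin n)) := WithLp.toLp 2 (1, 0)
  have he : ‖e‖ = 1 := by
    have := WithLp.prod_norm_sq_eq_of_L2 e
    change ‖e‖ ^ 2 = ‖(1 : ℝ)‖ ^ 2 + ‖(0 : EuclideanSpace ℝ (Fin n))‖ ^ 2 at this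
    rw [norm_one, norm_zero] at this
    nlinarith [norm_nonneg e]
  refine ⟨L₀.trans ((ℝ ∙ (L₀ x - e))ᗮ).reflection, ?_⟩
  have h : ‖L₀ x‖ = ‖e‖ := by rw [he, L₀.norm_map, hx]
  simpa using Submodule.reflection_sub h

/-- The cone over the spherical cap of chord radius `ρ` around the first coordinate vector. -/
def capCone (n : ℕ) (ρ : ℝ) : Set (WithLp 2 (ℝ × EuclideanSpace ℝ (Fin n))) :=
  {y | 0 < ‖y‖ ∧ ‖y‖ < 1 ∧ ‖y‖ * (1 - ρ ^ 2 / 2) < y.fst}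

theorem measurableSet_capCone (n : ℕ) (ρ : ℝ) : MeasurableSet (capCone n ρ) := by
  have : Measurable fun y : WithLp 2 (ℝ × EuclideanSpace ℝ (Fin n)) => y.fst :=
    measurable_fst.comp (WithLp.measurable_ofLp 2 _)
  exact ((measurableSet_lt measurable_const measurable_norm).inter
    ((measurableSet_lt measurable_norm measurable_const).inter
      (measurableSet_lt (measurable_norm.mul_const _) this)))

theorem sphere_dist_sq {d : ℕ} (x y : USphere d) :
    dist x y ^ 2 = 2 - 2 * ⟪(x : EuclideanSpace ℝ (Fin d)), (y : EuclideanSpace ℝ (Fin d))⟫ := by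
  rw [Subtype.dist_eq, dist_eq_norm, norm_sub_sq_real]
  simp; ring

/-- Chord distance below ρ means inner product above 1 - ρ²/2, a condition that becomes homogeneous
once multiplied by the norm. -/
theorem cone_ball_eq {n : ℕ} (x : USphere (n + 1)) {ρ : ℝ} (hρ : 0 < ρ)
    (L : EuclideanSpace ℝ (Fin (n + 1)) ≃ₗᵢ[ℝ] WithLp 2 (ℝ × EuclideanSpace ℝ (Fin n)))
    (hL : L x = WithLp.toLp 2 (1, 0)) :
    Ioo (0 : ℝ) 1 • ((↑) '' Metric.ball x ρ : Set (EuclideanSpace ℝ (Fin (n + 1)))) =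
      L ⁻¹' capCone n ρ := by
  have hfst : ∀ y, (L y).fst = ⟪y, (x : EuclideanSpace ℝ (Fin (n + 1)))⟫ := by
    intro y
    rw [← L.inner_map_map, hL, WithLp.prod_inner_apply]
    simp
  have hball : ∀ z : USphere (n + 1), z ∈ Metric.ball x ρ ↔
      1 - ρ ^ 2 / 2 < ⟪(z : EuclideanSpace ℝ (Fin (n + 1))), (x : EuclideanSpace ℝ (Fin (n + 1)))⟫ := by
    intro z
    rw [Metric.mem_ball, ← sq_lt_sq₀ dist_nonneg hρ.le, sphere_dist_sq]
    constructor <;> intro h <;> linarith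
  ext y
  simp only [Set.mem_smul, mem_image, mem_preimage, capCone, mem_ofPred_eq, hfst, L.norm_map]
  constructor
  · rintro ⟨t, ht, _, ⟨z, hz, rfl⟩, rfl⟩
    have hz1 : ‖(z : EuclideanSpace ℝ (Fin (n + 1)))‖ = 1 := by simp
    rw [norm_smul, hz1, mul_one, Real.norm_of_nonneg ht.1.le, real_inner_smul_left]
    exact ⟨ht.1, ht.2, mul_lt_mul_of_pos_left ((hball z).1 hz) ht.1⟩
  · rintro ⟨h0, h1, h2⟩
    have hz1 : ‖‖y‖⁻¹ • y‖ = 1 := by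
      rw [norm_smul, norm_inv, norm_norm, inv_mul_cancel₀ h0.ne']
    refine ⟨‖y‖, ⟨h0, h1⟩, ‖y‖⁻¹ • y, ⟨⟨‖y‖⁻¹ • y, by simpa using hz1⟩, ?_, rfl⟩, ?_⟩
    · rw [hball]
      simp only [real_inner_smul_left]
      rwa [← div_eq_inv_mul, lt_div_iff₀' h0]
    · beta_reduce
      rw [smul_smul, mul_inv_cancel₀ h0.ne', one_smul]

theorem uniformSphere_ball {n : ℕ} (x : USphere (n + 1)) {ρ : ℝ} (hρ : 0 < ρ) :
    uniformSphere (n + 1) (Metric.ball x ρ) = volume (capCone n ρ) /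
      volume (Metric.ball (0 : EuclideanSpace ℝ (Fin (n + 1))) 1) := by
  obtain ⟨L, hL⟩ := exists_linearIsometryEquiv_prod (x : EuclideanSpace ℝ (Fin (n + 1))) (by simp)
  rw [uniformSphere_apply measurableSet_ball, cone_ball_eq x hρ L hL,
    L.measurePreserving.measure_preimage (measurableSet_capCone n ρ).nullMeasurableSet]

/-- The uniform measure of a ball of radius `ρ` in the sphere (for the chord distance). -/
def capMeasure (d : ℕ) (ρ : ℝ) : ℝ≥0∞ := ⨆ x : USphere d, uniformSphere d (Metric.ball x ρ)

theorem uniformSphere_ball_eq {d : ℕ} (hd : 1 ≤ d) (x : USphere d) (ρ : ℝ) :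
    uniformSphere d (Metric.ball x ρ) = capMeasure d ρ := by
  obtain ⟨n, rfl⟩ := Nat.exists_eq_add_of_le' hd
  have : Nonempty (USphere (n + 1)) := ⟨x⟩
  rcases le_or_gt ρ 0 with h | h
  · simp [capMeasure, Metric.ball_eq_empty.2 h]
  · simp [capMeasure, uniformSphere_ball _ h]

theorem capMeasure_of_nonpos (d : ℕ) {ρ : ℝ} (h : ρ ≤ 0) : capMeasure d ρ = 0 := by
  simp [capMeasure, Metric.ball_eq_empty.2 h]

theorem capMeasure_le_one (d : ℕ) [NeZero d] (ρ : ℝ) : capMeasure d ρ ≤ 1 :=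
  iSup_le fun _ => prob_le_one

theorem capMeasure_ne_top (d : ℕ) [NeZero d] (ρ : ℝ) : capMeasure d ρ ≠ ⊤ :=
  ((capMeasure_le_one d ρ).trans_lt ENNReal.one_lt_top).ne

theorem capMeasure_mono (d : ℕ) : Monotone (capMeasure d) := fun _ _ h =>
  iSup_mono fun _ => measure_mono (Metric.ball_subset_ball h)

theorem measurable_capMeasure (d : ℕ) : Measurable (capMeasure d) := (capMeasure_mono d).measurable

/-! ### Measure of small caps by comparison with circular cones -/

/-- The solid circular cone with slope `c` and height `T`. -/
def solidCone (n : ℕ) (c T : ℝ) : Set (WithLp 2 (ℝ × EuclideanSpace ℝ (Fin n))) :=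
  {y | y.fst ∈ Ioo 0 T ∧ ‖y.snd‖ < c * y.fst}

theorem volume_solidCone {n : ℕ} [NeZero n] {c T : ℝ} (hc : 0 ≤ c) (hT : 0 ≤ T) :
    volume (solidCone n c T) = ENNReal.ofReal (c ^ n * T ^ (n + 1) / (n + 1)) *
      ENNReal.ofReal (√Real.pi ^ n / Real.Gamma (n / 2 + 1)) := by
  have hm : MeasurableSet {y : ℝ × EuclideanSpace ℝ (Fin n) | y.1 ∈ Ioo 0 T ∧ ‖y.2‖ < c * y.1} :=
    (measurable_fst measurableSet_Ioo).inter
      (measurableSet_lt measurable_snd.norm (measurable_fst.const_mul c))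
  have h1 : solidCone n c T = WithLp.ofLp ⁻¹'
      {y : ℝ × EuclideanSpace ℝ (Fin n) | y.1 ∈ Ioo 0 T ∧ ‖y.2‖ < c * y.1} := rfl
  rw [h1, (WithLp.volume_preserving_ofLp ℝ (EuclideanSpace ℝ (Fin n))).measure_preimage
    hm.nullMeasurableSet, Measure.volume_eq_prod, Measure.prod_apply hm]
  have h2 : ∀ t : ℝ, volume (Prod.mk t ⁻¹'
      {y : ℝ × EuclideanSpace ℝ (Fin n) | y.1 ∈ Ioo 0 T ∧ ‖y.2‖ < c * y.1}) =
      (Ioo 0 T).indicator (fun t => ENNReal.ofReal ((c * t) ^ n) *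
        ENNReal.ofReal (√Real.pi ^ n / Real.Gamma (n / 2 + 1))) t := by
    intro t
    by_cases ht : t ∈ Ioo 0 T
    · have : Prod.mk t ⁻¹' {y : ℝ × EuclideanSpace ℝ (Fin n) | y.1 ∈ Ioo 0 T ∧ ‖y.2‖ < c * y.1} =
          Metric.ball 0 (c * t) := by
        ext w; simp [ht.1, ht.2]
      rw [this, EuclideanSpace.volume_ball, indicator_of_mem ht, Fintype.card_fin,
        ENNReal.ofReal_pow (mul_nonneg hc ht.1.le)]
    · rw [indicator_of_notMem ht]
      convert! measure_empty (μ := (volume : Measure (EuclideanSpace ℝ (Fin n))))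
      ext w; simp only [mem_preimage, mem_ofPred_eq, mem_empty_iff_false, iff_false, not_and]
      exact fun h => absurd h ht
  simp_rw [h2]
  rw [lintegral_indicator measurableSet_Ioo, lintegral_mul_const _ (by fun_prop)]
  congr 1
  rw [Measure.restrict_congr_set Ioo_ae_eq_Ioc, ← ofReal_integral_eq_lintegral_ofReal,
    ← intervalIntegral.integral_of_le hT]
  · simp_rw [mul_pow]
    rw [intervalIntegral.integral_const_mul, integral_pow]
    simp [mul_div_assoc]
  · exact (Continuous.intervalIntegrable (by fun_prop) 0 T).1
  · filter_upwards [ae_restrict_mem measurableSet_Ioc] with t ht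
    have := ht.1
    positivity

/-- The constant in the asymptotics of the measure of small caps. -/
def capConst (d : ℕ) : ℝ :=
  Real.Gamma ((d : ℝ) / 2) / (√Real.pi * Real.Gamma (((d : ℝ) - 1) / 2) * ((d : ℝ) - 1))

theorem capConst_pos {d : ℕ} (hd : 2 ≤ d) : 0 < capConst d := by
  have h : (2 : ℝ) ≤ d := by exact_mod_cast hd
  have h1 : 0 < Real.Gamma ((d : ℝ) / 2) := Real.Gamma_pos_of_pos (by linarith)
  have h2 : 0 < Real.Gamma (((d : ℝ) - 1) / 2) := Real.Gamma_pos_of_pos (by linarith)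
  have h3 : 0 < (d : ℝ) - 1 := by linarith
  unfold capConst
  positivity

theorem gammaCrit_mul_capConst {d : ℕ} (hd : 2 ≤ d) : gammaCrit d * capConst d = d - 1 := by
  have h : (2 : ℝ) ≤ d := by exact_mod_cast hd
  have h1 : 0 < Real.Gamma ((d : ℝ) / 2) := Real.Gamma_pos_of_pos (by linarith)
  have h2 : 0 < Real.Gamma (((d : ℝ) - 1) / 2) := Real.Gamma_pos_of_pos (by linarith)
  have h3 : 0 < (d : ℝ) - 1 := by linarith
  have h4 := Real.sqrt_pos.2 Real.pi_pos
  unfold capConst gammaCrit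
  field_simp

/-- Ratio of the unit ball volumes in dimensions n and n + 1; the extra factor 1/(n + 1) comes from
integrating the slices of the cone. -/
theorem capConst_eq {n : ℕ} (hn : 1 ≤ n) :
    (√Real.pi ^ n / Real.Gamma (n / 2 + 1)) /
      (√Real.pi ^ (n + 1) / Real.Gamma (((n + 1 : ℕ) : ℝ) / 2 + 1)) / (n + 1) = capConst (n + 1) := by
  have h : (1 : ℝ) ≤ n := by exact_mod_cast hn
  have h1 : 0 < Real.Gamma (((n : ℝ) + 1) / 2) := Real.Gamma_pos_of_pos (by linarith)
  have h2 : 0 < Real.Gamma ((n : ℝ) / 2) := Real.Gamma_pos_of_pos (by linarith)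
  have h4 := Real.sqrt_pos.2 Real.pi_pos
  rw [Real.Gamma_add_one (by positivity), Real.Gamma_add_one (by positivity)]
  unfold capConst
  push_cast
  rw [add_sub_cancel_right, pow_succ]
  field_simp

/-- With h = 1 - ρ²/2 the cosine of the angular radius, the slope is its tangent. Cutting at height
h keeps the cone inside the unit ball, since the norm times h is below the first coordinate. -/
theorem solidCone_subset_capCone {n : ℕ} {ρ : ℝ} (hρ : 0 < ρ) (hρ1 : ρ ≤ 1) :
    solidCone n (√(1 - (1 - ρ ^ 2 / 2) ^ 2) / (1 - ρ ^ 2 / 2)) (1 - ρ ^ 2 / 2) ⊆ capCone n ρ := by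
  have hh : 0 < 1 - ρ ^ 2 / 2 := by nlinarith
  have hs : 0 ≤ 1 - (1 - ρ ^ 2 / 2) ^ 2 := by nlinarith [sq_nonneg ρ]
  set h := 1 - ρ ^ 2 / 2
  rintro y ⟨⟨h0, h1⟩, h2⟩
  have hn := WithLp.prod_norm_sq_eq_of_L2 y
  rw [Real.norm_eq_abs, sq_abs] at hn
  have h3 : ‖y.snd‖ ^ 2 * h ^ 2 < (1 - h ^ 2) * y.fst ^ 2 := by
    have : ‖y.snd‖ * h < √(1 - h ^ 2) * y.fst := by
      rwa [div_mul_eq_mul_div, lt_div_iff₀ hh] at h2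
    rw [← Real.sq_sqrt hs, ← mul_pow, ← mul_pow]
    exact pow_lt_pow_left₀ this (by positivity) two_ne_zero
  have h4 : ‖y‖ * h < y.fst := by
    refine lt_of_pow_lt_pow_left₀ 2 h0.le ?_
    rw [mul_pow, hn]; linarith
  refine ⟨?_, ?_, h4⟩
  · rw [norm_pos_iff]; rintro rfl; simp at h0
  · nlinarith [norm_nonneg y]

theorem capCone_subset_solidCone {n : ℕ} {ρ : ℝ} (hρ : 0 < ρ) (hρ1 : ρ ≤ 1) :
    capCone n ρ ⊆ solidCone n (√(1 - (1 - ρ ^ 2 / 2) ^ 2) / (1 - ρ ^ 2 / 2)) 1 := by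
  have hh : 0 < 1 - ρ ^ 2 / 2 := by nlinarith
  have hs : 0 ≤ 1 - (1 - ρ ^ 2 / 2) ^ 2 := by nlinarith [sq_nonneg ρ]
  set h := 1 - ρ ^ 2 / 2
  rintro y ⟨h0, h1, h2⟩
  have hn := WithLp.prod_norm_sq_eq_of_L2 y
  rw [Real.norm_eq_abs, sq_abs] at hn
  have h5 : 0 < y.fst := (mul_pos h0 hh).trans h2
  have h6 : y.fst ≤ ‖y‖ := by
    refine le_of_sq_le_sq ?_ (norm_nonneg y)
    nlinarith [sq_nonneg ‖y.snd‖]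
  refine ⟨⟨h5, by linarith⟩, ?_⟩
  rw [div_mul_eq_mul_div, lt_div_iff₀ hh]
  refine lt_of_pow_lt_pow_left₀ 2 (by positivity) ?_
  rw [mul_pow, mul_pow, Real.sq_sqrt hs]
  have := pow_lt_pow_left₀ (show ‖y‖ * h < y.fst from h2) (by positivity) two_ne_zero
  rw [mul_pow, hn] at this
  linarith

/-- The cap cone lies between two circular cones of the same slope with heights h and 1. The slope
is asymptotic to ρ and h tends to 1, so both volumes have the same leading term. -/
theorem tendsto_capMeasure {d : ℕ} (hd : 2 ≤ d) :
    Tendsto (fun ρ => (capMeasure d ρ).toReal / ρ ^ (d - 1)) (𝓝[>] 0) (𝓝 (capConst d)) := by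
  obtain ⟨n, rfl⟩ : ∃ n, d = n + 1 := ⟨d - 1, by omega⟩
  have hn : 1 ≤ n := by omega
  have : NeZero n := ⟨by omega⟩
  let x : USphere (n + 1) := ⟨EuclideanSpace.single 0 1, by simp⟩
  rw [add_tsub_cancel_right]
  set h : ℝ → ℝ := fun ρ => 1 - ρ ^ 2 / 2 with hh
  set A : ℝ := √Real.pi ^ n / Real.Gamma (n / 2 + 1)
  set B : ℝ := √Real.pi ^ (n + 1) / Real.Gamma (((n + 1 : ℕ) : ℝ) / 2 + 1)
  have hpi := Real.sqrt_pos.2 Real.pi_pos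
  have hA : 0 < A := div_pos (by positivity) (Real.Gamma_pos_of_pos (by positivity))
  have hB : 0 < B := div_pos (by positivity) (Real.Gamma_pos_of_pos (by positivity))
  have hvol : ∀ c T : ℝ, 0 ≤ c → 0 ≤ T → volume.real (solidCone n c T) / B =
      c ^ n * T ^ (n + 1) * capConst (n + 1) := by
    intro c T hc hT
    rw [measureReal_def, volume_solidCone hc hT, ← capConst_eq hn, ← ENNReal.ofReal_mul (by positivity),
      ENNReal.toReal_ofReal (by positivity)]
    ring
  have hcap : ∀ ρ, 0 < ρ → (capMeasure (n + 1) ρ).toReal = volume.real (capCone n ρ) / B := by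
    intro ρ hρ
    rw [← uniformSphere_ball_eq (by omega) x, uniformSphere_ball x hρ, ENNReal.toReal_div,
      EuclideanSpace.volume_ball, measureReal_def]
    simp only [ENNReal.ofReal_one, one_pow, one_mul, Fintype.card_fin]
    rw [ENNReal.toReal_ofReal hB.le]
  have hs : ∀ ρ : ℝ, 0 < ρ → √(1 - (h ρ) ^ 2) / h ρ = ρ * (√(1 - ρ ^ 2 / 4) / h ρ) := by
    intro ρ hρ
    rw [show 1 - (h ρ) ^ 2 = ρ ^ 2 * (1 - ρ ^ 2 / 4) by simp only [hh]; ring,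
      Real.sqrt_mul (by positivity), Real.sqrt_sq hρ.le, mul_div_assoc]
  have hfin : ∀ c T : ℝ, 0 ≤ c → 0 ≤ T → volume (solidCone n c T) ≠ ⊤ := fun c T hc hT => by
    rw [volume_solidCone hc hT]; exact ENNReal.mul_ne_top ENNReal.ofReal_ne_top ENNReal.ofReal_ne_top
  have key : ∀ᶠ ρ in 𝓝[>] (0 : ℝ), ρ ∈ Ioo (0 : ℝ) 1 := Ioo_mem_nhdsGT one_pos
  have hc : ∀ᶠ ρ in 𝓝[>] (0 : ℝ),
      (√(1 - ρ ^ 2 / 4) / h ρ) ^ n * h ρ ^ (n + 1) * capConst (n + 1) ≤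
        (capMeasure (n + 1) ρ).toReal / ρ ^ n ∧
      (capMeasure (n + 1) ρ).toReal / ρ ^ n ≤ (√(1 - ρ ^ 2 / 4) / h ρ) ^ n * capConst (n + 1) := by
    filter_upwards [key] with ρ hρ
    have hρ0 := hρ.1
    have hhp : 0 < h ρ := by simp only [hh]; nlinarith [hρ.1, hρ.2]
    have hcn : 0 ≤ √(1 - (h ρ) ^ 2) / h ρ := by positivity
    rw [le_div_iff₀ (by positivity), div_le_iff₀ (by positivity), hcap ρ hρ.1]
    constructor
    · calc _ = (√(1 - (h ρ) ^ 2) / h ρ) ^ n * h ρ ^ (n + 1) * capConst (n + 1) := by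
            rw [hs ρ hρ.1, mul_pow]; ring
        _ = volume.real (solidCone n (√(1 - (h ρ) ^ 2) / h ρ) (h ρ)) / B :=
            (hvol _ _ hcn hhp.le).symm
        _ ≤ _ := by
            refine div_le_div_of_nonneg_right
              (measureReal_mono (solidCone_subset_capCone hρ.1 hρ.2.le) ?_) hB.le
            exact measure_ne_top_of_subset (capCone_subset_solidCone hρ.1 hρ.2.le)
              (hfin _ _ hcn zero_le_one)
    · calc _ ≤ volume.real (solidCone n (√(1 - (h ρ) ^ 2) / h ρ) 1) / B := by
            exact div_le_div_of_nonneg_right (measureReal_mono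
              (capCone_subset_solidCone hρ.1 hρ.2.le) (hfin _ _ hcn zero_le_one)) hB.le
        _ = (√(1 - (h ρ) ^ 2) / h ρ) ^ n * 1 ^ (n + 1) * capConst (n + 1) :=
            hvol _ _ hcn zero_le_one
        _ = _ := by rw [hs ρ hρ.1, mul_pow]; ring
  have lim : ∀ F : ℝ → ℝ, ContinuousAt F 0 → Tendsto F (𝓝[>] 0) (𝓝 (F 0)) :=
    fun F hF => hF.tendsto.mono_left nhdsWithin_le_nhds
  have hh0 : h 0 ≠ 0 := by simp [hh]
  have hhc : Continuous h := by fun_prop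
  refine tendsto_of_tendsto_of_tendsto_of_le_of_le' ?_ ?_ (hc.mono fun _ h => h.1)
    (hc.mono fun _ h => h.2)
  · convert lim (fun ρ => (√(1 - ρ ^ 2 / 4) / h ρ) ^ n * h ρ ^ (n + 1) * capConst (n + 1))
      (by fun_prop (disch := assumption)) using 2
    simp [hh]
  · convert lim (fun ρ => (√(1 - ρ ^ 2 / 4) / h ρ) ^ n * capConst (n + 1))
      (by fun_prop (disch := assumption)) using 2
    simp [hh]

theorem exists_capMeasure_le {d : ℕ} (hd : 2 ≤ d) :
    ∃ C : ℝ, 0 < C ∧ ∀ ρ, 0 < ρ → capMeasure d ρ ≤ ENNReal.ofReal (C * ρ ^ (d - 1)) := by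
  have : NeZero d := ⟨by omega⟩
  obtain ⟨ρ₀, hρ₀, h⟩ := mem_nhdsGT_iff_exists_Ioo_subset.1
    ((tendsto_capMeasure hd).eventually_le_const (lt_add_one (capConst d)))
  have hρ₀ : 0 < ρ₀ := hρ₀
  have hc := capConst_pos hd
  -- The first entry serves radii below ρ₀, by the asymptotics; the second makes the bound at least
  -- 1 for all larger radii.
  refine ⟨max (capConst d + 1) (1 / ρ₀ ^ (d - 1)), lt_max_of_lt_left (by linarith), fun ρ hρ => ?_⟩
  rcases lt_or_ge ρ ρ₀ with h1 | h1
  · have := h ⟨hρ, h1⟩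
    rw [mem_ofPred_eq, div_le_iff₀ (by positivity)] at this
    rw [← ENNReal.ofReal_toReal (capMeasure_ne_top d ρ)]
    refine ENNReal.ofReal_le_ofReal (this.trans ?_)
    gcongr
    exact le_max_left _ _
  · refine (capMeasure_le_one d ρ).trans ?_
    rw [← ENNReal.ofReal_one]
    refine ENNReal.ofReal_le_ofReal ?_
    calc (1 : ℝ) ≤ ρ ^ (d - 1) / ρ₀ ^ (d - 1) := by
          rw [one_le_div (by positivity)]; gcongr
      _ = 1 / ρ₀ ^ (d - 1) * ρ ^ (d - 1) := by ring
      _ ≤ _ := by gcongr; exact le_max_right _ _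

theorem uniformSphere_singleton {d : ℕ} (hd : 2 ≤ d) (x : USphere d) :
    uniformSphere d {x} = 0 := by
  obtain ⟨C, hC, h⟩ := exists_capMeasure_le hd
  have hlim : Tendsto (fun ρ : ℝ => ENNReal.ofReal (C * ρ ^ (d - 1))) (𝓝[>] 0) (𝓝 0) := by
    have : Continuous fun ρ : ℝ => ENNReal.ofReal (C * ρ ^ (d - 1)) :=
      ENNReal.continuous_ofReal.comp (by fun_prop)
    have h2 := (this.tendsto 0).mono_left (nhdsWithin_le_nhds (s := Ioi 0))
    rwa [zero_pow (by omega), mul_zero, ENNReal.ofReal_zero] at h2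
  refine le_antisymm (ge_of_tendsto hlim ?_) zero_le
  filter_upwards [self_mem_nhdsWithin] with ρ hρ
  have hρ : 0 < ρ := hρ
  calc uniformSphere d {x} ≤ uniformSphere d (Metric.ball x ρ) :=
        measure_mono (by simpa using hρ)
    _ = capMeasure d ρ := uniformSphere_ball_eq (by omega) x ρ
    _ ≤ _ := h ρ hρ

/-- The Riesz potentials of order `α < d - 1` of the uniform distribution are bounded. -/
theorem exists_riesz_bound {d : ℕ} (hd : 2 ≤ d) {α : ℝ} (hα : 0 < α) (hα1 : α < d - 1) :
    ∃ C : ℝ≥0∞, C ≠ ⊤ ∧ ∀ x : USphere d,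
      ∫⁻ y, ENNReal.ofReal (dist x y ^ (-α)) ∂(uniformSphere d) ≤ C := by
  have : NeZero d := ⟨by omega⟩
  obtain ⟨K, hK, h⟩ := exists_capMeasure_le hd
  -- Layer cake: the set where the potential exceeds t is contained in a ball of radius t^(-1/α), of
  -- measure O(t^(-β)). Since β > 1 the tail is integrable, and levels up to 1 contribute at most 1.
  set β : ℝ := ((d : ℝ) - 1) / α with hβ
  have hβ1 : 1 < β := by rw [hβ, lt_div_iff₀ hα]; linarith
  refine ⟨1 + ∫⁻ t in Ioi (1 : ℝ), ENNReal.ofReal (K * t ^ (-β)), ?_, fun x => ?_⟩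
  · refine ENNReal.add_ne_top.2 ⟨ENNReal.one_ne_top, ?_⟩
    have := (integrableOn_Ioi_rpow_of_lt (show -β < -1 by linarith) one_pos).const_mul K
    exact this.lintegral_lt_top.ne
  · rw [lintegral_eq_lintegral_meas_lt _ (Eventually.of_forall fun y => Real.rpow_nonneg dist_nonneg _)
      (by fun_prop), ← Ioc_union_Ioi_eq_Ioi (zero_le_one' ℝ)]
    refine (lintegral_union_le _ _ _).trans (add_le_add ?_ ?_)
    · refine (setLIntegral_mono measurable_const fun t _ => prob_le_one).trans ?_
      simp
    · refine setLIntegral_mono (by fun_prop) fun t ht => ?_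
      have ht : 1 < t := ht
      have ht0 : 0 < t := by linarith
      have hsub : {y | t < dist x y ^ (-α)} ⊆ Metric.ball x (t ^ (-α⁻¹)) := by
        intro y hy
        have hy : t < dist x y ^ (-α) := hy
        have h0 : 0 < dist x y := by
          refine lt_of_le_of_ne dist_nonneg fun h => ?_
          rw [← h, Real.zero_rpow (by linarith)] at hy
          linarith
        rw [Metric.mem_ball, dist_comm]
        have := Real.rpow_lt_rpow_of_neg ht0 hy (show -α⁻¹ < 0 by simpa using hα)
        rwa [← Real.rpow_mul h0.le, neg_mul_neg, mul_inv_cancel₀ hα.ne', Real.rpow_one] at this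
      refine (measure_mono hsub).trans ?_
      rw [uniformSphere_ball_eq (by omega)]
      refine (h _ (by positivity)).trans (le_of_eq ?_)
      rw [← Real.rpow_natCast, ← Real.rpow_mul ht0.le, Nat.cast_sub (by omega), hβ]
      congr 3
      push_cast
      ring

/-! ### The Laplace functional of a Poisson process and void probabilities of marked processes -/

section Laplace

variable {Ω E : Type*} [MeasurableSpace Ω] [MeasurableSpace E] {P : Measure Ω}
  {X : ℕ → Ω → E} {μ : Measure E}

theorem IsPoissonPointProcess.ae_finite (hX : IsPoissonPointProcess X μ P) {B : Set E}
    (hB : MeasurableSet B) (hμ : μ B ≠ ⊤) : ∀ᵐ ω ∂P, {n | X n ω ∈ B}.Finite := by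
  have h : ∀ᵐ ω ∂P, pointCount X B ω ≠ ⊤ := by
    rw [(hX.count_law B hB hμ).ae_iff (p := fun k => k ≠ ⊤) (measurable_of_countable _),
      ae_map_iff (measurable_of_countable _).aemeasurable (MeasurableSet.of_discrete)]
    exact Eventually.of_forall fun n => ENat.natCast_ne_top n
  filter_upwards [h] with ω hω
  exact encard_ne_top_iff.1 hω

/-- The generating function of the Poisson law; `toNat` loses nothing, because the law charges only
finite counts. -/
theorem IsPoissonPointProcess.integral_pow_count (hX : IsPoissonPointProcess X μ P) {B : Set E}
    (hB : MeasurableSet B) (hμ : μ B ≠ ⊤) (c : ℝ) :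
    ∫ ω, c ^ (pointCount X B ω).toNat ∂P = Real.exp (-((1 - c) * μ.real B)) := by
  have h := (hX.count_law B hB hμ).integral_comp (f := fun k : ℕ∞ => c ^ k.toNat)
    (measurable_of_countable _).aestronglyMeasurable
  simp only [Function.comp_def] at h
  rw [h, integral_map (measurable_of_countable _).aemeasurable
    (measurable_of_countable _).aestronglyMeasurable, integral_poissonMeasure]
  simp only [ENat.toNat_natCast, smul_eq_mul]
  set m : ℝ := ((μ B).toNNReal : ℝ) with hm
  have hs := (NormedSpace.expSeries_div_hasSum_exp (m * c)).mul_left (Real.exp (-m))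
  rw [← Real.exp_eq_exp_ℝ, ← Real.exp_add] at hs
  have hmr : μ.real B = m := rfl
  rw [hmr, show -((1 - c) * m) = -m + m * c by ring, ← hs.tsum_eq]
  exact tsum_congr fun n => by rw [mul_pow]; ring

theorem finprod_ite_mem_eq_pow {ι : Type*} {T : Set ι} (hT : T.Finite) [DecidablePred (· ∈ T)] (c : ℝ) :
    ∏ᶠ n, (if n ∈ T then c else 1) = c ^ T.encard.toNat := by
  rw [finprod_eq_prod_of_mulSupport_subset (s := hT.toFinset)]
  · rw [Finset.prod_congr rfl fun n hn => if_pos (hT.mem_toFinset.1 hn), Finset.prod_const,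
      ← ncard_def, ncard_eq_toFinset_card T hT]
  · intro n hn
    by_contra h
    exact hn (if_neg fun h' => h (by simpa using h'))

open Classical in
-- The Laplace functional for a step function: grouping points by cell turns the product into powers
-- of independent Poisson counts. Almost surely only finitely many factors differ from 1, so
-- `finprod` does not take its default value.
theorem IsPoissonPointProcess.integral_finprod_simple (hX : IsPoissonPointProcess X μ P) {m : ℕ}
    {B : Fin m → Set E} (hB : ∀ i, MeasurableSet (B i)) (hμ : ∀ i, μ (B i) ≠ ⊤)
    (hd : Pairwise (Function.onFun Disjoint B)) (c : Fin m → ℝ) :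
    ∫ ω, ∏ᶠ n, ∏ i, (if X n ω ∈ B i then c i else 1) ∂P =
      Real.exp (-∑ i, (1 - c i) * μ.real (B i)) := by
  have h1 : ∀ᵐ ω ∂P, ∏ᶠ n, ∏ i, (if X n ω ∈ B i then c i else 1) =
      ∏ i, c i ^ (pointCount X (B i) ω).toNat := by
    have := ae_all_iff.2 fun i => hX.ae_finite (hB i) (hμ i)
    filter_upwards [this] with ω hω
    rw [finprod_prod_comm]
    · exact Finset.prod_congr rfl fun i _ => finprod_ite_mem_eq_pow (hω i) (c i)
    · intro i _
      refine (hω i).subset fun n hn => ?_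
      by_contra h
      exact hn (if_neg h)
  rw [integral_congr_ae h1, (hX.count_indep m B hB hd).integral_fun_prod_comp
    (f := fun i k => c i ^ k.toNat) (fun i => (hX.count_law _ (hB i) (hμ i)).aemeasurable)
    (fun i => (measurable_of_countable _).aestronglyMeasurable),
    Finset.prod_congr rfl fun i _ => hX.integral_pow_count (hB i) (hμ i) (c i), ← Real.exp_sum,
    Finset.sum_neg_distrib]

theorem finprod_eq_prod_of_eq_one_off {E : Type*} {x : ℕ → E} {W : Set E}
    (hf : {n | x n ∈ W}.Finite) {q : E → ℝ} (hq : ∀ e ∉ W, q e = 1) :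
    ∏ᶠ n, q (x n) = ∏ n ∈ hf.toFinset, q (x n) := by
  refine finprod_eq_prod_of_mulSupport_subset _ fun n hn => ?_
  by_contra h
  exact hn (hq _ (by simpa using h))

theorem tendsto_prod_range_finprod {E : Type*} {x : ℕ → E} {W : Set E}
    (hf : {n | x n ∈ W}.Finite) {q : E → ℝ} (hq : ∀ e ∉ W, q e = 1) :
    Tendsto (fun N => ∏ n ∈ Finset.range N, q (x n)) atTop (𝓝 (∏ᶠ n, q (x n))) := by
  refine tendsto_const_nhds.congr' ?_
  obtain ⟨N₀, hN₀⟩ := hf.toFinset.exists_nat_subset_range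
  filter_upwards [eventually_ge_atTop N₀] with N hN
  refine finprod_eq_prod_of_mulSupport_subset _ fun n hn => ?_
  have hn' : n ∈ hf.toFinset := by
    by_contra h
    exact hn (hq _ (by simpa using h))
  exact Finset.coe_subset.2 (hN₀.trans (Finset.range_mono hN)) hn'

theorem IsPoissonPointProcess.tendsto_integral_prod_range [IsProbabilityMeasure P]
    (hX : IsPoissonPointProcess X μ P) {W : Set E} (hW : MeasurableSet W) (hμ : μ W ≠ ⊤)
    {q : E → ℝ} (hq : Measurable q) (h0 : ∀ e, 0 ≤ q e) (h1 : ∀ e, q e ≤ 1)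
    (hoff : ∀ e ∉ W, q e = 1) :
    Tendsto (fun N => ∫ ω, ∏ n ∈ Finset.range N, q (X n ω) ∂P) atTop
      (𝓝 (∫ ω, ∏ᶠ n, q (X n ω) ∂P)) := by
  refine tendsto_integral_of_dominated_convergence (fun _ => 1) (fun N => ?_)
    (integrable_const 1) (fun N => Eventually.of_forall fun ω => ?_) ?_
  · exact (Finset.measurable_fun_prod _ fun n _ => hq.comp (hX.measurable n)).aestronglyMeasurable
  · rw [Real.norm_of_nonneg (Finset.prod_nonneg fun n _ => h0 _)]
    exact Finset.prod_le_one (fun n _ => h0 _) fun n _ => h1 _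
  · filter_upwards [hX.ae_finite hW hμ] with ω hω
    exact tendsto_prod_range_finprod hω hoff

theorem IsPoissonPointProcess.aestronglyMeasurable_finprod
    (hX : IsPoissonPointProcess X μ P) {W : Set E} (hW : MeasurableSet W) (hμ : μ W ≠ ⊤)
    {q : E → ℝ} (hq : Measurable q) (hoff : ∀ e ∉ W, q e = 1) :
    AEStronglyMeasurable (fun ω => ∏ᶠ n, q (X n ω)) P := by
  refine aestronglyMeasurable_of_tendsto_ae atTop
    (f := fun N ω => ∏ n ∈ Finset.range N, q (X n ω)) (fun N => ?_) ?_
  · exact (Finset.measurable_fun_prod _ fun n _ => hq.comp (hX.measurable n)).aestronglyMeasurable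
  · filter_upwards [hX.ae_finite hW hμ] with ω hω
    exact tendsto_prod_range_finprod hω hoff

open Classical in
/-- A function with values in `[0, 1]`, rounded down to a multiple of `1 / k` on `W`. -/
def roundOn (W : Set E) (q : E → ℝ) (k : ℕ) (e : E) : ℝ := if e ∈ W then (⌊q e * k⌋₊ : ℝ) / k else 1

open Classical in
theorem IsPoissonPointProcess.integral_finprod_roundOn [IsProbabilityMeasure P]
    (hX : IsPoissonPointProcess X μ P) {W : Set E} (hW : MeasurableSet W) (hμ : μ W ≠ ⊤)
    {q : E → ℝ} (hq : Measurable q) (h1 : ∀ e, q e ≤ 1) (k : ℕ) :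
    ∫ ω, ∏ᶠ n, roundOn W q k (X n ω) ∂P = Real.exp (-∫ e in W, (1 - roundOn W q k e) ∂μ) := by
  -- There are k + 1 levels, since the value 1 is allowed and gives the floor k.
  set B : Fin (k + 1) → Set E := fun i => W ∩ {e | ⌊q e * k⌋₊ = i} with hBdef
  have hfl : Measurable fun e => ⌊q e * k⌋₊ := Nat.measurable_floor.comp (hq.mul_const _)
  have hB : ∀ i, MeasurableSet (B i) := fun i => hW.inter (hfl (measurableSet_singleton _))
  have hBμ : ∀ i, μ (B i) ≠ ⊤ := fun i => measure_ne_top_of_subset inter_subset_left hμ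
  have hd : Pairwise (Function.onFun Disjoint B) := by
    intro i j hij
    refine Set.disjoint_left.2 fun e hi hj => hij (Fin.ext ?_)
    exact hi.2.symm.trans hj.2
  have hlt : ∀ e, ⌊q e * k⌋₊ < k + 1 := by
    intro e
    refine Nat.lt_succ_of_le (Nat.floor_le_of_le ?_)
    exact mul_le_of_le_one_left (Nat.cast_nonneg k) (h1 e)
  have hmem : ∀ e ∈ W, ∀ i, e ∈ B i ↔ i = ⟨⌊q e * k⌋₊, hlt e⟩ := by
    intro e he i
    simp only [hBdef, mem_inter_iff, he, true_and, mem_ofPred_eq, Fin.ext_iff]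
    exact eq_comm
  have hprod : ∀ e, roundOn W q k e = ∏ i, (if e ∈ B i then ((i : ℕ) : ℝ) / k else 1) := by
    intro e
    by_cases he : e ∈ W
    · simp only [roundOn, if_pos he, hmem e he, Finset.prod_ite_eq', Finset.mem_univ, if_true]
    · rw [roundOn, if_neg he, Finset.prod_congr rfl fun i _ => if_neg fun h => he h.1,
        Finset.prod_const_one]
  have hsum : ∀ e ∈ W, 1 - roundOn W q k e =
      ∑ i, (B i).indicator (fun _ => 1 - ((i : ℕ) : ℝ) / k) e := by
    intro e he
    simp only [indicator_apply, hmem e he, Finset.sum_ite_eq', Finset.mem_univ, if_true, roundOn,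
      if_pos he]
  have hsimple : ∫ ω, ∏ᶠ n, roundOn W q k (X n ω) ∂P =
      Real.exp (-∑ i : Fin (k + 1), (1 - ((i : ℕ) : ℝ) / k) * μ.real (B i)) := by
    rw [← hX.integral_finprod_simple hB hBμ hd fun i => ((i : ℕ) : ℝ) / k]
    refine integral_congr_ae (Eventually.of_forall fun ω => finprod_congr fun n => ?_)
    convert hprod (X n ω)
  rw [hsimple, setIntegral_congr_fun hW hsum, integral_finsetSum]
  · congr 2
    refine Finset.sum_congr rfl fun i _ => ?_
    rw [integral_indicator_const _ (hB i), measureReal_restrict_apply (hB i),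
      inter_eq_left.2 inter_subset_left, smul_eq_mul, mul_comm]
  · intro i _
    refine (integrable_indicator_iff (hB i)).2 (integrableOn_const ?_)
    exact ((Measure.restrict_apply_le _ _).trans_lt (hBμ i).lt_top).ne

/-- The general Laplace functional follows from rounded functions by dominated convergence on both
sides: products and integrands lie in [0, 1], and W has finite mass. -/
theorem IsPoissonPointProcess.integral_finprod [IsProbabilityMeasure P]
    (hX : IsPoissonPointProcess X μ P) {W : Set E} (hW : MeasurableSet W) (hμ : μ W ≠ ⊤)
    {q : E → ℝ} (hq : Measurable q) (h0 : ∀ e, 0 ≤ q e) (h1 : ∀ e, q e ≤ 1)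
    (hoff : ∀ e ∉ W, q e = 1) :
    ∫ ω, ∏ᶠ n, q (X n ω) ∂P = Real.exp (-∫ e in W, (1 - q e) ∂μ) := by
  classical
  have hoff' : ∀ k, ∀ e ∉ W, roundOn W q k e = 1 := fun k e he => if_neg he
  have hm : ∀ k, Measurable (roundOn W q k) := fun k =>
    Measurable.ite hW ((measurable_from_top.comp
      (Nat.measurable_floor.comp (hq.mul_const _))).div_const _) measurable_const
  have hr0 : ∀ k e, 0 ≤ roundOn W q k e := by
    intro k e; unfold roundOn; split_ifs <;> positivity
  have hr1 : ∀ k e, roundOn W q k e ≤ 1 := by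
    intro k e; unfold roundOn; split_ifs
    · refine div_le_one_of_le₀ ?_ (Nat.cast_nonneg k)
      exact (Nat.floor_le (mul_nonneg (h0 e) (Nat.cast_nonneg k))).trans
        (mul_le_of_le_one_left (Nat.cast_nonneg k) (h1 e))
    · exact le_rfl
  have hlim : ∀ e, Tendsto (fun k => roundOn W q k e) atTop (𝓝 (q e)) := by
    intro e
    by_cases he : e ∈ W
    · simp only [roundOn, if_pos he]
      exact (tendsto_nat_floor_mul_div_atTop (h0 e)).comp tendsto_natCast_atTop_atTop
    · simp only [roundOn, if_neg he, hoff e he]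
      exact tendsto_const_nhds
  have hL : Tendsto (fun k => ∫ ω, ∏ᶠ n, roundOn W q k (X n ω) ∂P) atTop
      (𝓝 (∫ ω, ∏ᶠ n, q (X n ω) ∂P)) := by
    refine tendsto_integral_of_dominated_convergence (fun _ => 1)
      (fun k => hX.aestronglyMeasurable_finprod hW hμ (hm k) (hoff' k)) (integrable_const 1)
      (fun k => ?_) ?_
    · filter_upwards [hX.ae_finite hW hμ] with ω hω
      rw [finprod_eq_prod_of_eq_one_off hω (hoff' k),
        Real.norm_of_nonneg (Finset.prod_nonneg fun n _ => hr0 _ _)]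
      exact Finset.prod_le_one (fun n _ => hr0 _ _) fun n _ => hr1 _ _
    · filter_upwards [hX.ae_finite hW hμ] with ω hω
      simp_rw [finprod_eq_prod_of_eq_one_off hω (hoff' _), finprod_eq_prod_of_eq_one_off hω hoff]
      exact tendsto_finsetProd _ fun n _ => hlim _
  have hR : Tendsto (fun k => Real.exp (-∫ e in W, (1 - roundOn W q k e) ∂μ)) atTop
      (𝓝 (Real.exp (-∫ e in W, (1 - q e) ∂μ))) := by
    refine (Real.continuous_exp.tendsto _).comp (Tendsto.neg ?_)
    refine tendsto_integral_of_dominated_convergence (fun _ => 1)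
      (fun k => (measurable_const.sub (hm k)).aestronglyMeasurable) (integrableOn_const hμ)
      (fun k => Eventually.of_forall fun e => ?_) (Eventually.of_forall fun e => ?_)
    · rw [Real.norm_of_nonneg (sub_nonneg.2 (hr1 k e))]
      linarith [hr0 k e]
    · exact tendsto_const_nhds.sub (hlim e)
  exact tendsto_nhds_unique hL
    (hR.congr fun k => (hX.integral_finprod_roundOn hW hμ hq h1 k).symm)

/-! ### Independent marks -/

variable {Y : Type*} [MeasurableSpace Y] {σ : Measure Y} [IsProbabilityMeasure σ]

/-- Independence of marks and positions makes their joint law a product, so the positions can be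
frozen; the marks then avoid their sections of S independently. -/
theorem measure_forall_lt_notMem [IsProbabilityMeasure P] {U : ℕ → Ω → Y}
    (hXm : ∀ n, Measurable (X n)) (hUm : ∀ n, Measurable (U n)) (hU : iIndepFun U P)
    (hUσ : ∀ n, HasLaw (U n) σ P) (hUX : IndepFun (fun ω n => U n ω) (fun ω n => X n ω) P)
    {S : Set (E × Y)} (hS : MeasurableSet S) (N : ℕ) :
    P.real {ω | ∀ n < N, (X n ω, U n ω) ∉ S} =
      ∫ ω, ∏ n ∈ Finset.range N, (1 - σ.real (Prod.mk (X n ω) ⁻¹' S)) ∂P := by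
  have hU' : Measurable fun ω n => U n ω := measurable_pi_lambda _ hUm
  have hX' : Measurable fun ω n => X n ω := measurable_pi_lambda _ hXm
  have hD : MeasurableSet {z : (ℕ → Y) × (ℕ → E) | ∀ n < N, (z.2 n, z.1 n) ∉ S} := by
    have : {z : (ℕ → Y) × (ℕ → E) | ∀ n < N, (z.2 n, z.1 n) ∉ S} =
        ⋂ n, ⋂ (_ : n < N), (fun z => (z.2 n, z.1 n)) ⁻¹' Sᶜ := by ext; simp
    rw [this]
    refine MeasurableSet.iInter fun n => MeasurableSet.iInter fun _ => ?_
    exact (by fun_prop : Measurable fun z : (ℕ → Y) × (ℕ → E) => (z.2 n, z.1 n)) hS.compl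
  have hinner : ∀ x : ℕ → E, P.map (fun ω n => U n ω) {y | ∀ n < N, (x n, y n) ∉ S} =
      ∏ n ∈ Finset.range N, σ (Prod.mk (x n) ⁻¹' Sᶜ) := by
    intro x
    have hm : ∀ n, MeasurableSet (Prod.mk (x n) ⁻¹' Sᶜ) := fun n => measurable_prodMk_left hS.compl
    have hset : (fun ω n => U n ω) ⁻¹' {y | ∀ n < N, (x n, y n) ∉ S} =
        ⋂ n ∈ Finset.range N, U n ⁻¹' (Prod.mk (x n) ⁻¹' Sᶜ) := by ext; simp
    have hD' : MeasurableSet {y : ℕ → Y | ∀ n < N, (x n, y n) ∉ S} :=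
      (measurable_prodMk_right (y := x)) hD
    rw [Measure.map_apply hU' hD', hset, hU.measure_inter_preimage_eq_mul _ fun n _ => hm n]
    refine Finset.prod_congr rfl fun n _ => ?_
    rw [← (hUσ n).map_eq, Measure.map_apply (hUm n) (hm n)]
  have hq : ∀ e, 1 - σ.real (Prod.mk e ⁻¹' S) = (σ (Prod.mk e ⁻¹' Sᶜ)).toReal := by
    intro e
    rw [preimage_compl, ← measureReal_def, probReal_compl_eq_one_sub (measurable_prodMk_left hS)]
  have hmq : Measurable fun e => σ (Prod.mk e ⁻¹' Sᶜ) := measurable_measure_prodMk_left hS.compl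
  have key : P {ω | ∀ n < N, (X n ω, U n ω) ∉ S} =
      ∫⁻ ω, ∏ n ∈ Finset.range N, σ (Prod.mk (X n ω) ⁻¹' Sᶜ) ∂P := by
    have h1 : P {ω | ∀ n < N, (X n ω, U n ω) ∉ S} =
        P.map (fun ω => (fun n => U n ω, fun n => X n ω))
          {z : (ℕ → Y) × (ℕ → E) | ∀ n < N, (z.2 n, z.1 n) ∉ S} :=
      (Measure.map_apply (hU'.prodMk hX') hD).symm
    have : IsProbabilityMeasure (P.map fun ω n => U n ω) :=
      Measure.isProbabilityMeasure_map hU'.aemeasurable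
    have : IsProbabilityMeasure (P.map fun ω n => X n ω) :=
      Measure.isProbabilityMeasure_map hX'.aemeasurable
    rw [h1, (indepFun_iff_map_prod_eq_prod_map_map hU'.aemeasurable hX'.aemeasurable).1 hUX,
      Measure.prod_apply_symm hD]
    rw [lintegral_map (measurable_measure_prodMk_right hD) hX']
    exact lintegral_congr fun ω => hinner fun n => X n ω
  rw [measureReal_def, key, ← integral_toReal]
  · exact integral_congr_ae (Eventually.of_forall fun ω => by
      simp only [ENNReal.toReal_prod, hq])
  · exact (Finset.measurable_fun_prod _ fun n _ => hmq.comp (hXm n)).aemeasurable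
  · refine Eventually.of_forall fun ω => (Finset.prod_le_one' fun n _ => ?_).trans_lt
      ENNReal.one_lt_top
    exact prob_le_one

/-- Void probabilities of an independently marked Poisson process. -/
theorem IsPoissonPointProcess.measure_forall_notMem [IsProbabilityMeasure P] [SFinite μ]
    (hX : IsPoissonPointProcess X μ P) {U : ℕ → Ω → Y}
    (hUm : ∀ n, Measurable (U n)) (hU : iIndepFun U P)
    (hUσ : ∀ n, HasLaw (U n) σ P) (hUX : IndepFun (fun ω n => U n ω) (fun ω n => X n ω) P)
    {W : Set E} (hW : MeasurableSet W) (hμ : μ W ≠ ⊤)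
    {S : Set (E × Y)} (hS : MeasurableSet S) (hSW : S ⊆ W ×ˢ univ) :
    P.real {ω | ∀ n, (X n ω, U n ω) ∉ S} = Real.exp (-(μ.prod σ).real S) := by
  have hmq : Measurable fun e => σ.real (Prod.mk e ⁻¹' S) :=
    (measurable_measure_prodMk_left hS).ennreal_toReal
  have hoff : ∀ e ∉ W, Prod.mk e ⁻¹' S = ∅ := fun e he => by
    ext y
    simp only [mem_preimage, mem_empty_iff_false, iff_false]
    exact fun h => he (hSW h).1
  -- Averaging over the marks replaces the avoidance event by the Laplace functional of q(e) = 1 -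
  -- σ(S_e), whose exponent integrates to the product measure of S.
  have hlim := hX.tendsto_integral_prod_range hW hμ
    (q := fun e => 1 - σ.real (Prod.mk e ⁻¹' S)) (measurable_const.sub hmq)
    (fun e => sub_nonneg.2 measureReal_le_one) (fun e => sub_le_self _ measureReal_nonneg)
    (fun e he => by simp [hoff e he])
  rw [hX.integral_finprod hW hμ (q := fun e => 1 - σ.real (Prod.mk e ⁻¹' S))
    (measurable_const.sub hmq)
    (fun e => sub_nonneg.2 measureReal_le_one) (fun e => sub_le_self _ measureReal_nonneg)
    (fun e he => by simp [hoff e he])] at hlim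
  simp only [sub_sub_cancel] at hlim
  have hint : ∫ e in W, σ.real (Prod.mk e ⁻¹' S) ∂μ = (μ.prod σ).real S := by
    rw [measureReal_def, Measure.prod_apply hS]
    simp only [measureReal_def]
    rw [integral_toReal (measurable_measure_prodMk_left hS).aemeasurable
      (Eventually.of_forall fun e => measure_lt_top _ _), ← lintegral_indicator hW]
    congr 1
    refine lintegral_congr fun e => ?_
    by_cases he : e ∈ W
    · rw [indicator_of_mem he]
    · rw [indicator_of_notMem he, hoff e he, measure_empty]
  rw [hint] at hlim
  have hanti : Antitone fun N : ℕ => {ω | ∀ n < N, (X n ω, U n ω) ∉ S} :=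
    fun M N h ω hω n hn => hω n (hn.trans_le h)
  have hmeas : ∀ N : ℕ, MeasurableSet {ω | ∀ n < N, (X n ω, U n ω) ∉ S} := by
    intro N
    have : {ω | ∀ n < N, (X n ω, U n ω) ∉ S} =
        ⋂ n, ⋂ (_ : n < N), (fun ω => (X n ω, U n ω)) ⁻¹' Sᶜ := by ext; simp
    rw [this]
    exact MeasurableSet.iInter fun n => MeasurableSet.iInter fun _ =>
      ((hX.measurable n).prodMk (hUm n)) hS.compl
  have hI : ⋂ N : ℕ, {ω | ∀ n < N, (X n ω, U n ω) ∉ S} = {ω | ∀ n, (X n ω, U n ω) ∉ S} := by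
    ext ω
    simp only [mem_iInter, mem_ofPred_eq]
    exact ⟨fun h n => h (n + 1) n n.lt_succ_self, fun h _ n _ => h n⟩
  have hlim2 := tendsto_measure_iInter_atTop (fun N => (hmeas N).nullMeasurableSet) hanti
    ⟨0, measure_ne_top P _⟩
  rw [hI] at hlim2
  have hlim3 := (ENNReal.tendsto_toReal (measure_ne_top P _)).comp hlim2
  refine tendsto_nhds_unique hlim3 (hlim.congr fun N => ?_)
  exact (measure_forall_lt_notMem hX.measurable hUm hU hUσ hUX hS N).symm

end Laplace

/-! ### Random caps on the sphere: first and second moments of the uncovered set -/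

/-- Uniform independent directions `u n`, and an independent Poisson process `r` of intensity `μ`. -/
structure IsCapProcess {Ω : Type*} [MeasurableSpace Ω] {d : ℕ} (u : ℕ → Ω → USphere d)
    (r : ℕ → Ω → ℝ) (μ : Measure ℝ) (P : Measure Ω) : Prop where
  measurable_dir : ∀ n, Measurable (u n)
  indep_dir : iIndepFun u P
  unif_dir : ∀ n, HasLaw (u n) (uniformSphere d) P
  poisson : IsPoissonPointProcess r μ P
  indep : IndepFun (fun ω n => u n ω) (fun ω n => r n ω) P

/-- The points of the sphere at chord distance at least `g (r n)` from `u n`, for all `n`. -/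
def uncovered {Ω : Type*} {d : ℕ} (u : ℕ → Ω → USphere d) (r : ℕ → Ω → ℝ) (g : ℝ → ℝ) (ω : Ω) :
    Set (USphere d) :=
  {x | ∀ n, g (r n ω) ≤ dist x (u n ω)}

/-- The pairs (distance, direction) of caps that contain `x`. -/
def capHits {d : ℕ} (g : ℝ → ℝ) (x : USphere d) : Set (ℝ × USphere d) := {z | dist x z.2 < g z.1}

theorem measurableSet_capHits {d : ℕ} {g : ℝ → ℝ} (hg : Measurable g) (x : USphere d) :
    MeasurableSet (capHits g x) :=
  measurableSet_lt (measurable_const.dist measurable_snd) (hg.comp measurable_fst)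

theorem isClosed_uncovered {Ω : Type*} {d : ℕ} (u : ℕ → Ω → USphere d) (r : ℕ → Ω → ℝ) (g : ℝ → ℝ)
    (ω : Ω) : IsClosed (uncovered u r g ω) := by
  simp only [uncovered, ofPred_forall]
  exact isClosed_iInter fun n => isClosed_le continuous_const (continuous_id.dist continuous_const)

theorem prod_capHits {d : ℕ} (hd : 1 ≤ d) (μ : Measure ℝ) [SFinite μ] {g : ℝ → ℝ}
    (hg : Measurable g) (x : USphere d) :
    (μ.prod (uniformSphere d)) (capHits g x) = ∫⁻ ρ, capMeasure d (g ρ) ∂μ := by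
  have : NeZero d := ⟨by omega⟩
  rw [Measure.prod_apply (measurableSet_capHits hg x)]
  refine lintegral_congr fun ρ => ?_
  rw [← uniformSphere_ball_eq hd x]
  congr 1
  ext y
  exact Metric.mem_ball'.symm

/-- By the triangle inequality a cap of radius g can contain both points only if their distance is
below 2g. -/
theorem prod_capHits_inter_le {d : ℕ} (hd : 1 ≤ d) (μ : Measure ℝ) [SFinite μ] {g : ℝ → ℝ}
    (hg : Measurable g) (x y : USphere d) :
    (μ.prod (uniformSphere d)) (capHits g x ∩ capHits g y) ≤
      ∫⁻ ρ in {ρ | dist x y < 2 * g ρ}, capMeasure d (g ρ) ∂μ := by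
  have : NeZero d := ⟨by omega⟩
  have hm : MeasurableSet {ρ | dist x y < 2 * g ρ} :=
    measurableSet_lt measurable_const (hg.const_mul 2)
  rw [Measure.prod_apply ((measurableSet_capHits hg x).inter (measurableSet_capHits hg y)),
    ← lintegral_indicator hm]
  refine lintegral_mono fun ρ => ?_
  by_cases hρ : dist x y < 2 * g ρ
  · rw [indicator_of_mem (by exact hρ), ← uniformSphere_ball_eq hd x]
    exact measure_mono fun z hz => Metric.mem_ball'.2 hz.1
  · rw [indicator_of_notMem (by exact hρ)]
    refine le_of_eq ?_
    convert measure_empty (μ := uniformSphere d)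
    ext z
    simp only [mem_preimage, mem_inter_iff, mem_empty_iff_false, iff_false]
    rintro ⟨h1, h2⟩
    have h1 : dist x z < g ρ := h1
    have h2 : dist y z < g ρ := h2
    have := dist_triangle_right x y z
    linarith

section Moments

variable {Ω : Type*} [MeasurableSpace Ω] {P : Measure Ω} [IsProbabilityMeasure P] {d : ℕ}
  {u : ℕ → Ω → USphere d} {r : ℕ → Ω → ℝ} {μ : Measure ℝ} [SFinite μ] {g : ℝ → ℝ} {W : Set ℝ}

omit [IsProbabilityMeasure P] [SFinite μ] in
theorem IsCapProcess.measurableSet_mem_uncovered (h : IsCapProcess u r μ P) (hg : Measurable g) :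
    MeasurableSet {z : Ω × USphere d | z.2 ∈ uncovered u r g z.1} := by
  have : {z : Ω × USphere d | z.2 ∈ uncovered u r g z.1} =
      ⋂ n, {z | g (r n z.1) ≤ dist z.2 (u n z.1)} := by
    ext z; simp [uncovered]
  rw [this]
  refine MeasurableSet.iInter fun n => measurableSet_le ?_ ?_
  · exact hg.comp ((h.poisson.measurable n).comp measurable_fst)
  · exact measurable_snd.dist ((h.measurable_dir n).comp measurable_fst)

omit [IsProbabilityMeasure P] [SFinite μ] in
theorem IsCapProcess.measurable_measure_uncovered (hd : 1 ≤ d) (h : IsCapProcess u r μ P)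
    (hg : Measurable g) : Measurable fun ω => uniformSphere d (uncovered u r g ω) := by
  have : NeZero d := ⟨by omega⟩
  exact measurable_measure_prodMk_left (h.measurableSet_mem_uncovered hg)

theorem capHits_subset (hgW : ∀ ρ ∉ W, g ρ ≤ 0) (x : USphere d) : capHits g x ⊆ W ×ˢ univ := by
  intro z hz
  refine ⟨?_, mem_univ _⟩
  by_contra hW
  have hz : dist x z.2 < g z.1 := hz
  linarith [hgW _ hW, dist_nonneg (x := x) (y := z.2)]

omit [SFinite μ] in
theorem prod_subset_lt_top (hd : 1 ≤ d) (hμ : μ W ≠ ⊤) :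
    (μ.prod (uniformSphere d)) (W ×ˢ univ) < ⊤ := by
  have : NeZero d := ⟨by omega⟩
  rw [Measure.prod_prod, measure_univ, mul_one]
  exact hμ.lt_top

theorem IsCapProcess.measure_mem_uncovered (hd : 1 ≤ d) (h : IsCapProcess u r μ P)
    (hg : Measurable g) (hW : MeasurableSet W) (hμ : μ W ≠ ⊤) (hgW : ∀ ρ ∉ W, g ρ ≤ 0)
    (x : USphere d) :
    P {ω | x ∈ uncovered u r g ω} =
      ENNReal.ofReal (Real.exp (-(∫⁻ ρ, capMeasure d (g ρ) ∂μ).toReal)) := by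
  have : NeZero d := ⟨by omega⟩
  rw [← prod_capHits hd μ hg x, ← measureReal_def, ← h.poisson.measure_forall_notMem
    h.measurable_dir h.indep_dir h.unif_dir h.indep hW hμ (measurableSet_capHits hg x)
    (capHits_subset hgW x), ofReal_measureReal]
  simp [uncovered, capHits]

/-- The void exponent of a union is the sum of the two exponents minus that of the intersection, so
the correlation comes only from caps containing both points. -/
theorem IsCapProcess.measure_pair_mem_uncovered_le (hd : 1 ≤ d) (h : IsCapProcess u r μ P)
    (hg : Measurable g) (hW : MeasurableSet W) (hμ : μ W ≠ ⊤) (hgW : ∀ ρ ∉ W, g ρ ≤ 0)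
    (x y : USphere d) :
    P {ω | x ∈ uncovered u r g ω ∧ y ∈ uncovered u r g ω} ≤
      ENNReal.ofReal (Real.exp (-(∫⁻ ρ, capMeasure d (g ρ) ∂μ).toReal)) ^ 2 *
      ENNReal.ofReal (Real.exp
        (∫⁻ ρ in {ρ | dist x y < 2 * g ρ}, capMeasure d (g ρ) ∂μ).toReal) := by
  have : NeZero d := ⟨by omega⟩
  have hx := measurableSet_capHits hg x
  have hy := measurableSet_capHits hg y
  have hfin : ∀ {S : Set (ℝ × USphere d)}, S ⊆ W ×ˢ univ → (μ.prod (uniformSphere d)) S ≠ ⊤ :=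
    fun hS => ((measure_mono hS).trans_lt (prod_subset_lt_top hd hμ)).ne
  have hsx := capHits_subset hgW x
  have hsy := capHits_subset hgW y
  have hset : {ω | x ∈ uncovered u r g ω ∧ y ∈ uncovered u r g ω} =
      {ω | ∀ n, (r n ω, u n ω) ∉ capHits g x ∪ capHits g y} := by
    ext ω
    simp [uncovered, capHits, forall_and]
  have hadd := measureReal_union_add_inter (μ := μ.prod (uniformSphere d)) (s := capHits g x) hy
    (hfin hsx) (hfin hsy)
  have hI : (μ.prod (uniformSphere d)).real (capHits g x ∩ capHits g y) ≤
      (∫⁻ ρ in {ρ | dist x y < 2 * g ρ}, capMeasure d (g ρ) ∂μ).toReal := by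
    refine ENNReal.toReal_mono ?_ (prod_capHits_inter_le hd μ hg x y)
    refine ((setLIntegral_le_lintegral _ _).trans_lt ?_).ne
    rw [← prod_capHits hd μ hg x]
    exact (hfin hsx).lt_top
  rw [hset, ← ofReal_measureReal, h.poisson.measure_forall_notMem
    h.measurable_dir h.indep_dir h.unif_dir h.indep hW hμ (hx.union hy) (union_subset hsx hsy),
    ← ENNReal.ofReal_pow (Real.exp_pos _).le, ← ENNReal.ofReal_mul (by positivity), ← Real.exp_nat_mul,
    ← Real.exp_add]
  refine ENNReal.ofReal_le_ofReal (Real.exp_le_exp.2 ?_)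
  have e1 : (μ.prod (uniformSphere d)).real (capHits g x) =
      (∫⁻ ρ, capMeasure d (g ρ) ∂μ).toReal := by rw [measureReal_def, prod_capHits hd μ hg x]
  have e2 : (μ.prod (uniformSphere d)).real (capHits g y) =
      (∫⁻ ρ, capMeasure d (g ρ) ∂μ).toReal := by rw [measureReal_def, prod_capHits hd μ hg y]
  push_cast
  linarith

theorem IsCapProcess.lintegral_measure_uncovered (hd : 1 ≤ d) (h : IsCapProcess u r μ P)
    (hg : Measurable g) (hW : MeasurableSet W) (hμ : μ W ≠ ⊤) (hgW : ∀ ρ ∉ W, g ρ ≤ 0) :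
    ∫⁻ ω, uniformSphere d (uncovered u r g ω) ∂P =
      ENNReal.ofReal (Real.exp (-(∫⁻ ρ, capMeasure d (g ρ) ∂μ).toReal)) := by
  have : NeZero d := ⟨by omega⟩
  have hD := h.measurableSet_mem_uncovered hg
  have h1 := Measure.prod_apply (μ := P) (ν := uniformSphere d) hD
  rw [Measure.prod_apply_symm hD] at h1
  refine h1.symm.trans ?_
  rw [← mul_one (ENNReal.ofReal _), ← measure_univ (μ := uniformSphere d), ← lintegral_const]
  exact lintegral_congr fun x => h.measure_mem_uncovered hd hg hW hμ hgW x

theorem IsCapProcess.lintegral_measure_uncovered_sq_le (hd : 1 ≤ d) (h : IsCapProcess u r μ P)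
    (hg : Measurable g) (hW : MeasurableSet W) (hμ : μ W ≠ ⊤) (hgW : ∀ ρ ∉ W, g ρ ≤ 0) {C : ℝ≥0∞}
    (hC : ∀ x : USphere d, ∫⁻ y, ENNReal.ofReal (Real.exp
      (∫⁻ ρ in {ρ | dist x y < 2 * g ρ}, capMeasure d (g ρ) ∂μ).toReal) ∂(uniformSphere d) ≤ C) :
    ∫⁻ ω, uniformSphere d (uncovered u r g ω) ^ 2 ∂P ≤
      ENNReal.ofReal (Real.exp (-(∫⁻ ρ, capMeasure d (g ρ) ∂μ).toReal)) ^ 2 * C := by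
  have : NeZero d := ⟨by omega⟩
  have hD := h.measurableSet_mem_uncovered hg
  have hD2 : MeasurableSet {z : Ω × (USphere d × USphere d) |
      z.2.1 ∈ uncovered u r g z.1 ∧ z.2.2 ∈ uncovered u r g z.1} :=
    ((by fun_prop : Measurable fun z : Ω × (USphere d × USphere d) => (z.1, z.2.1)) hD).inter
      ((by fun_prop : Measurable fun z : Ω × (USphere d × USphere d) => (z.1, z.2.2)) hD)
  have h1 := Measure.prod_apply (μ := P) (ν := (uniformSphere d).prod (uniformSphere d)) hD2
  rw [Measure.prod_apply_symm hD2] at h1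
  have h2 : ∀ ω, uniformSphere d (uncovered u r g ω) ^ 2 =
      ((uniformSphere d).prod (uniformSphere d)) (Prod.mk ω ⁻¹' {z : Ω × (USphere d × USphere d) |
      z.2.1 ∈ uncovered u r g z.1 ∧ z.2.2 ∈ uncovered u r g z.1}) := by
    intro ω
    rw [sq, ← Measure.prod_prod]
    rfl
  simp_rw [h2]
  rw [← h1]
  set c := ENNReal.ofReal (Real.exp (-(∫⁻ ρ, capMeasure d (g ρ) ∂μ).toReal)) with hc
  calc _ ≤ ∫⁻ x, ∫⁻ y, c ^ 2 * ENNReal.ofReal (Real.exp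
        (∫⁻ ρ in {ρ | dist x y < 2 * g ρ}, capMeasure d (g ρ) ∂μ).toReal)
          ∂(uniformSphere d) ∂(uniformSphere d) := by
        rw [lintegral_prod _ (measurable_measure_prodMk_right hD2).aemeasurable]
        exact lintegral_mono fun x => lintegral_mono fun y =>
          h.measure_pair_mem_uncovered_le hd hg hW hμ hgW x y
    _ ≤ ∫⁻ x, c ^ 2 * C ∂(uniformSphere d) := by
        refine lintegral_mono fun x => ?_
        rw [lintegral_const_mul' _ _ (by simp [hc])]
        exact mul_le_mul_right (hC x) _
    _ = c ^ 2 * C := by rw [lintegral_const, measure_univ, mul_one]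

/-- A second moment bound for the probability that the random caps leave a set of positive
measure uncovered. -/
theorem IsCapProcess.one_le_measure_uncovered_ne_zero_mul (hd : 1 ≤ d) (h : IsCapProcess u r μ P)
    (hg : Measurable g) (hW : MeasurableSet W) (hμ : μ W ≠ ⊤) (hgW : ∀ ρ ∉ W, g ρ ≤ 0) {C : ℝ≥0∞}
    (hC : ∀ x : USphere d, ∫⁻ y, ENNReal.ofReal (Real.exp
      (∫⁻ ρ in {ρ | dist x y < 2 * g ρ}, capMeasure d (g ρ) ∂μ).toReal) ∂(uniformSphere d) ≤ C) :
    1 ≤ P {ω | uniformSphere d (uncovered u r g ω) ≠ 0} * C := by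
  have : NeZero d := ⟨by omega⟩
  have h1 := h.lintegral_measure_uncovered hd hg hW hμ hgW
  have h2 := h.lintegral_measure_uncovered_sq_le hd hg hW hμ hgW hC
  set c := ENNReal.ofReal (Real.exp (-(∫⁻ ρ, capMeasure d (g ρ) ∂μ).toReal)) with hc
  set F := fun ω => uniformSphere d (uncovered u r g ω) with hF
  have hFm : Measurable F := h.measurable_measure_uncovered hd hg
  have hA : MeasurableSet {ω | F ω ≠ 0} := hFm (measurableSet_singleton 0).compl
  -- Cauchy-Schwarz against the indicator of F ≠ 0. The squared mean c² appears on both sides and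
  -- cancels, so the bound depends on C alone and survives the limit of growing truncations.
  have hcs := ENNReal.lintegral_mul_le_Lp_mul_Lq P Real.HolderConjugate.two_two
    (f := F) (g := {ω | F ω ≠ 0}.indicator 1) hFm.aemeasurable
    ((measurable_const (a := (1 : ℝ≥0∞))).indicator hA).aemeasurable
  have e1 : ∫⁻ ω, (F * {ω | F ω ≠ 0}.indicator (1 : Ω → ℝ≥0∞)) ω ∂P = c := by
    rw [← h1]
    refine lintegral_congr fun ω => ?_
    change F ω * {ω | F ω ≠ 0}.indicator (1 : Ω → ℝ≥0∞) ω = F ω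
    by_cases hω : F ω = 0
    · simp [hω]
    · simp [hω]
  have e2 : ∫⁻ ω, ({ω | F ω ≠ 0}.indicator (1 : Ω → ℝ≥0∞) ω) ^ (2 : ℝ) ∂P = P {ω | F ω ≠ 0} := by
    rw [← lintegral_indicator_one hA]
    refine lintegral_congr fun ω => ?_
    by_cases hω : F ω = 0
    · simp [hω]
    · simp [hω]
  have e3 : ∫⁻ ω, F ω ^ (2 : ℝ) ∂P ≤ c ^ 2 * C := by
    simpa only [ENNReal.rpow_two] using h2
  rw [e1, e2] at hcs
  have h3 : c ^ 2 ≤ (c ^ 2 * C) * P {ω | F ω ≠ 0} := by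
    calc c ^ 2 ≤ ((∫⁻ ω, F ω ^ (2 : ℝ) ∂P) ^ (1 / 2 : ℝ) * P {ω | F ω ≠ 0} ^ (1 / 2 : ℝ)) ^ 2 := by
          gcongr
      _ = (∫⁻ ω, F ω ^ (2 : ℝ) ∂P) * P {ω | F ω ≠ 0} := by
          rw [mul_pow, ← ENNReal.rpow_two, ← ENNReal.rpow_two, ← ENNReal.rpow_mul,
            ← ENNReal.rpow_mul]
          norm_num
      _ ≤ _ := by gcongr
  have hc0 : c ^ 2 ≠ 0 := by
    refine pow_ne_zero _ ?_
    rw [hc, Ne, ENNReal.ofReal_eq_zero, not_le]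
    exact Real.exp_pos _
  have hct : c ^ 2 ≠ ⊤ := by simp [hc]
  rw [mul_assoc, mul_comm C] at h3
  by_contra hcon
  rw [not_le] at hcon
  have := ENNReal.mul_lt_mul_right hc0 hct hcon
  rw [mul_one] at this
  exact absurd h3 (not_le.2 this)

/-- The second moment bound for a family of caps with infinitely many members. -/
theorem IsCapProcess.exists_one_le_measure_mul_uncovered_nonempty (hd : 1 ≤ d) (h : IsCapProcess u r μ P)
    (hr : ∀ᵐ ω ∂P, ∀ n, r n ω ∈ Ioo (0 : ℝ) 1)
    (hμ : ∀ b < 1, μ (Ioo 0 b) ≠ ⊤) (hg : Measurable g) (hg0 : ∀ ρ, 0 ≤ g ρ)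
    {F : ℝ → ℝ} (hF0 : ∀ t, 0 ≤ F t)
    (hF : ∀ t, 0 < t → ∫⁻ ρ in {ρ | t < 2 * g ρ}, capMeasure d (g ρ) ∂μ ≤ ENNReal.ofReal (F t))
    {C : ℝ≥0∞} (hC0 : C ≠ ⊤) (hsing : ∀ x : USphere d, uniformSphere d {x} = 0)
    (hC : ∀ x : USphere d, ∫⁻ y, ENNReal.ofReal (Real.exp (F (dist x y))) ∂(uniformSphere d) ≤ C) :
    ∃ A : Set Ω, MeasurableSet A ∧ 1 ≤ P A * C ∧ ∀ᵐ ω ∂P, ω ∈ A → (uncovered u r g ω).Nonempty := by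
  classical
  have : NeZero d := ⟨by omega⟩
  -- Truncation levels increasing to 1: each keeps a finite intensity, and every radius below 1 is
  -- eventually included.
  set b : ℕ → ℝ := fun k => 1 - 1 / ((k : ℝ) + 1) with hb
  have hb1 : ∀ k, b k < 1 := fun k => by
    have : (0 : ℝ) < 1 / ((k : ℝ) + 1) := by positivity
    simp only [hb]; linarith
  have hbm : Monotone b := fun k l hkl => by
    simp only [hb]
    have : 1 / ((l : ℝ) + 1) ≤ 1 / ((k : ℝ) + 1) := by gcongr
    linarith
  set G : ℕ → ℝ → ℝ := fun k => (Ioo 0 (b k)).indicator g with hG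
  have hGg : ∀ k ρ, G k ρ ≤ g ρ := fun k ρ => indicator_le_self' (fun _ _ => hg0 _) ρ
  have hGm : ∀ k, Measurable (G k) := fun k => hg.indicator measurableSet_Ioo
  have hGmono : Monotone G := fun k l hkl =>
    indicator_le_indicator_of_subset (Ioo_subset_Ioo_right (hbm hkl)) hg0
  have hanti : ∀ ω, Antitone fun k => uncovered u r (G k) ω := fun ω k l hkl x hx n =>
    (hGmono hkl _).trans (hx n)
  have hbound : ∀ k, 1 ≤ P {ω | uniformSphere d (uncovered u r (G k) ω) ≠ 0} * C := by
    intro k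
    refine h.one_le_measure_uncovered_ne_zero_mul hd (hGm k) measurableSet_Ioo (hμ _ (hb1 k))
      (fun ρ hρ => (indicator_of_notMem hρ _).le) fun x => (lintegral_mono_ae ?_).trans (hC x)
    -- The diagonal must be discarded, since `hF` controls only positive distances.
    have hne : ∀ᵐ y ∂(uniformSphere d), y ≠ x := compl_mem_ae_iff.2 (hsing x)
    filter_upwards [hne] with y hy
    refine ENNReal.ofReal_le_ofReal (Real.exp_le_exp.2 ?_)
    refine ENNReal.toReal_le_of_le_ofReal (hF0 _) (le_trans ?_ (hF _ (dist_pos.2 hy.symm)))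
    have hsub : {ρ | dist x y < 2 * G k ρ} ⊆ {ρ | dist x y < 2 * g ρ} := fun ρ hρ =>
      lt_of_lt_of_le (show dist x y < 2 * G k ρ from hρ) (by linarith [hGg k ρ])
    exact (lintegral_mono_set hsub).trans
      (lintegral_mono fun ρ => capMeasure_mono d (hGg k ρ))
  have hmeas : ∀ k, MeasurableSet {ω | uniformSphere d (uncovered u r (G k) ω) ≠ 0} := fun k =>
    h.measurable_measure_uncovered hd (hGm k) (measurableSet_singleton 0).compl
  have hlim := tendsto_measure_iInter_atTop (μ := P)
    (s := fun k => {ω | uniformSphere d (uncovered u r (G k) ω) ≠ 0})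
    (fun k => (hmeas k).nullMeasurableSet)
    (fun k l hkl ω hω => fun h0 => hω (measure_mono_null (hanti ω hkl) h0))
    ⟨0, measure_ne_top P _⟩
  have hle : 1 ≤ P (⋂ k, {ω | uniformSphere d (uncovered u r (G k) ω) ≠ 0}) * C :=
    ge_of_tendsto' (ENNReal.Tendsto.mul_const hlim (Or.inr hC0)) hbound
  refine ⟨_, MeasurableSet.iInter hmeas, hle, ?_⟩
  filter_upwards [hr] with ω hω hmem
  have hne : ∀ k, (uncovered u r (G k) ω).Nonempty := fun k =>
    nonempty_of_measure_ne_zero (mem_iInter.1 hmem k)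
  -- Cantor's intersection theorem: the uncovered sets are closed and decrease with the truncation
  -- level.
  obtain ⟨x, hx⟩ := IsCompact.nonempty_iInter_of_sequence_nonempty_isCompact_isClosed
    (fun k => uncovered u r (G k) ω) (fun k => hanti ω k.le_succ) hne
    (isClosed_uncovered u r _ ω).isCompact fun k => isClosed_uncovered u r _ ω
  refine ⟨x, fun n => ?_⟩
  obtain ⟨k, hk⟩ := exists_nat_one_div_lt (sub_pos.2 (hω n).2)
  have := mem_iInter.1 hx k n
  have hmem' : r n ω ∈ Ioo 0 (b k) := ⟨(hω n).1, by simp only [hb]; linarith⟩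
  simpa only [hG, indicator_of_mem hmem'] using this

/-- A first moment bound for the probability that some point is not covered by caps enlarged
by `ε`. -/
theorem IsCapProcess.measure_uncovered_nonempty_mul_le (hd : 1 ≤ d) (h : IsCapProcess u r μ P)
    (hg : Measurable g) (hW : MeasurableSet W) (hμ : μ W ≠ ⊤) (hgW : ∀ ρ ∉ W, g ρ ≤ 0) (ε : ℝ) :
    P {ω | ∃ x : USphere d, ∀ n, g (r n ω) + ε ≤ dist x (u n ω)} * capMeasure d ε ≤
      ENNReal.ofReal (Real.exp (-(∫⁻ ρ, capMeasure d (g ρ) ∂μ).toReal)) := by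
  have : NeZero d := ⟨by omega⟩
  rw [← h.lintegral_measure_uncovered hd hg hW hμ hgW, mul_comm]
  refine le_trans ?_ (mul_meas_ge_le_lintegral (h.measurable_measure_uncovered hd hg)
    (capMeasure d ε))
  refine mul_le_mul_right (measure_mono ?_) _
  -- If x is missed with margin ε, the whole ε-ball around x is uncovered, so Markov's inequality
  -- applies at the level `capMeasure d ε`.
  rintro ω ⟨x, hx⟩
  rw [mem_ofPred_eq, ← uniformSphere_ball_eq hd x]
  refine measure_mono fun y hy n => ?_
  have := dist_triangle_left x (u n ω) y
  rw [Metric.mem_ball] at hy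
  linarith [hx n]

end Moments

/-! ### Asymptotics of the cap radius and the intensity -/

/-- The chord radius of the shadow cap of height `shadowHeight lam r`. -/
def capRadius (lam r : ℝ) : ℝ := √(2 - 2 * shadowHeight lam r)

theorem capRadius_nonneg (lam r : ℝ) : 0 ≤ capRadius lam r := Real.sqrt_nonneg _

theorem measurable_capRadius (lam : ℝ) : Measurable (capRadius lam) := by
  unfold capRadius shadowHeight
  fun_prop

theorem shadowHeight_nonneg {lam r : ℝ} (hlam : 0 ≤ lam) (hr : r ∈ Ioo (0 : ℝ) 1) :
    0 ≤ shadowHeight lam r := by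
  have := hr.1
  unfold shadowHeight
  positivity

/-- The squared sine of the cap's angular radius is a perfect square of a rational function, which
makes the order 1 - r explicit. -/
theorem one_sub_shadowHeight_sq {lam r : ℝ} (hlam : 0 ≤ lam) (hr : r ∈ Ioo (0 : ℝ) 1) :
    1 - shadowHeight lam r ^ 2 = ((1 - r ^ 2) / (1 + 2 * lam * r + r ^ 2)) ^ 2 := by
  have h0 := hr.1
  have hD : 0 < 1 + 2 * lam * r + r ^ 2 := by positivity
  unfold shadowHeight
  rw [div_pow, mul_pow, Real.sq_sqrt (by positivity), div_pow]
  field_simp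
  ring

theorem shadowHeight_lt_one {lam r : ℝ} (hlam : 0 ≤ lam) (hr : r ∈ Ioo (0 : ℝ) 1) :
    shadowHeight lam r < 1 := by
  have h0 := hr.1
  have h1 : 0 < 1 - r ^ 2 := by nlinarith [hr.1, hr.2]
  have h2 := one_sub_shadowHeight_sq hlam hr
  have h3 : 0 < ((1 - r ^ 2) / (1 + 2 * lam * r + r ^ 2)) ^ 2 := by positivity
  nlinarith [shadowHeight_nonneg hlam hr]

theorem capRadius_pos {lam r : ℝ} (hlam : 0 ≤ lam) (hr : r ∈ Ioo (0 : ℝ) 1) :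
    0 < capRadius lam r :=
  Real.sqrt_pos.2 (by linarith [shadowHeight_lt_one hlam hr])

theorem capRadius_sq {lam r : ℝ} (hlam : 0 ≤ lam) (hr : r ∈ Ioo (0 : ℝ) 1) :
    capRadius lam r ^ 2 = 2 - 2 * shadowHeight lam r :=
  Real.sq_sqrt (by linarith [shadowHeight_lt_one hlam hr])

theorem mem_openCap_iff {d : ℕ} {lam r : ℝ} (hlam : 0 ≤ lam) (hr : r ∈ Ioo (0 : ℝ) 1)
    (x u : USphere d) : x ∈ openCap u (shadowHeight lam r) ↔ dist x u < capRadius lam r := by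
  rw [← sq_lt_sq₀ dist_nonneg (capRadius_nonneg _ _), capRadius_sq hlam hr, sphere_dist_sq]
  change shadowHeight lam r < ⟪(x : EuclideanSpace ℝ (Fin d)), (u : EuclideanSpace ℝ (Fin d))⟫ ↔ _
  constructor <;> intro h <;> linarith

theorem mem_closedCap_iff {d : ℕ} {lam r : ℝ} (hlam : 0 ≤ lam) (hr : r ∈ Ioo (0 : ℝ) 1)
    (x u : USphere d) : x ∈ closedCap u (shadowHeight lam r) ↔ dist x u ≤ capRadius lam r := by
  rw [← sq_le_sq₀ dist_nonneg (capRadius_nonneg _ _), capRadius_sq hlam hr, sphere_dist_sq]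
  change shadowHeight lam r ≤ ⟪(x : EuclideanSpace ℝ (Fin d)), (u : EuclideanSpace ℝ (Fin d))⟫ ↔ _
  constructor <;> intro h <;> linarith

/-- Writing 2 - 2φ as 2(1 - φ²)/(1 + φ) cancels the factor 1 - r and leaves an expression continuous
at r = 1. -/
theorem capRadius_div_eq {lam r : ℝ} (hlam : 0 ≤ lam) (hr : r ∈ Ioo (0 : ℝ) 1) :
    capRadius lam r / (1 - r) =
      (1 + r) / (1 + 2 * lam * r + r ^ 2) * √(2 / (1 + shadowHeight lam r)) := by
  have h0 := hr.1
  have h1 : 0 < 1 - r := sub_pos.2 hr.2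
  have hD : 0 < 1 + 2 * lam * r + r ^ 2 := by positivity
  have hφ := shadowHeight_nonneg hlam hr
  have hs := one_sub_shadowHeight_sq hlam hr
  have h2 : 2 - 2 * shadowHeight lam r = ((1 - r ^ 2) / (1 + 2 * lam * r + r ^ 2)) ^ 2 *
      (2 / (1 + shadowHeight lam r)) := by
    rw [← hs]; field_simp; ring
  have h3 : 0 ≤ (1 - r ^ 2) / (1 + 2 * lam * r + r ^ 2) := by
    apply div_nonneg _ hD.le; nlinarith
  rw [capRadius, h2, Real.sqrt_mul (sq_nonneg _), Real.sqrt_sq h3]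
  field_simp
  ring

theorem eventually_mem_Ioo_zero_one : ∀ᶠ r in 𝓝[<] (1 : ℝ), r ∈ Ioo (0 : ℝ) 1 :=
  Ioo_mem_nhdsLT one_pos

theorem tendsto_capRadius_div {lam : ℝ} (hlam : 0 ≤ lam) :
    Tendsto (fun r => capRadius lam r / (1 - r)) (𝓝[<] 1) (𝓝 (1 / (1 + lam))) := by
  have hφ1 : shadowHeight lam 1 = 1 := by
    unfold shadowHeight
    rw [show 1 * (lam + 1) * (1 + lam * 1) = (1 + lam) ^ 2 by ring, Real.sqrt_sq (by linarith)]
    rw [div_eq_one_iff_eq (by positivity)]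
    ring
  have hc : ContinuousAt (shadowHeight lam) 1 := by
    unfold shadowHeight
    have : 1 + 2 * lam * 1 + 1 ^ 2 ≠ 0 := by positivity
    fun_prop (disch := assumption)
  have hD : 1 + 2 * lam * 1 + 1 ^ 2 ≠ 0 := by positivity
  have hE : 1 + shadowHeight lam 1 ≠ 0 := by rw [hφ1]; norm_num
  have hcont : ContinuousAt (fun r => (1 + r) / (1 + 2 * lam * r + r ^ 2) *
      √(2 / (1 + shadowHeight lam r))) 1 := by
    fun_prop (disch := assumption)
  have hlim := hcont.tendsto.mono_left (nhdsWithin_le_nhds (s := Iio 1))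
  have hval : (1 + 1) / (1 + 2 * lam * 1 + 1 ^ 2) * √(2 / (1 + shadowHeight lam 1)) =
      1 / (1 + lam) := by
    rw [hφ1, show (2 : ℝ) / (1 + 1) = 1 by norm_num, Real.sqrt_one]
    field_simp
    ring
  rw [hval] at hlim
  refine hlim.congr' ?_
  filter_upwards [eventually_mem_Ioo_zero_one] with r hr using (capRadius_div_eq hlam hr).symm

theorem tendsto_capRadius {lam : ℝ} (hlam : 0 ≤ lam) :
    Tendsto (capRadius lam) (𝓝[<] 1) (𝓝 0) := by
  have h1 : Tendsto (fun r : ℝ => 1 - r) (𝓝[<] 1) (𝓝 0) := by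
    have : Continuous fun r : ℝ => 1 - r := by fun_prop
    simpa using (this.tendsto 1).mono_left (nhdsWithin_le_nhds (s := Iio 1))
  have h2 := (tendsto_capRadius_div hlam).mul h1
  rw [mul_zero] at h2
  refine h2.congr' ?_
  filter_upwards [eventually_mem_Ioo_zero_one] with r hr
  exact div_mul_cancel₀ _ (sub_pos.2 hr.2).ne'

theorem tendsto_radialDensity_mul (d : ℕ) (hd : 1 ≤ d) {lam : ℝ} (hlam : 0 ≤ lam) (γ : ℝ) :
    Tendsto (fun r => radialDensity d lam γ r * (1 - r) ^ d) (𝓝[<] 1)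
      (𝓝 (γ * (1 + lam) ^ (d - 1))) := by
  have hD : ((1 : ℝ) + 1) ^ d ≠ 0 := by positivity
  have hcont : ContinuousAt (fun r : ℝ => 2 * γ * (1 + 2 * lam * r + r ^ 2) ^ (d - 1) / (1 + r) ^ d)
      1 := by
    fun_prop (disch := assumption)
  have hlim := hcont.tendsto.mono_left (nhdsWithin_le_nhds (s := Iio 1))
  have hval : 2 * γ * (1 + 2 * lam * 1 + 1 ^ 2) ^ (d - 1) / (1 + 1) ^ d =
      γ * (1 + lam) ^ (d - 1) := by
    obtain ⟨n, rfl⟩ := Nat.exists_eq_add_of_le' hd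
    rw [add_tsub_cancel_right, show 1 + 2 * lam * 1 + 1 ^ 2 = (1 + 1) * (1 + lam) by ring, mul_pow,
      pow_succ]
    field_simp
    norm_num [mul_comm]
  rw [hval] at hlim
  refine hlim.congr' ?_
  filter_upwards [eventually_mem_Ioo_zero_one] with r hr
  have h1 : 0 < 1 - r := sub_pos.2 hr.2
  have h2 : 0 < 1 + r := by linarith [hr.1]
  rw [radialDensity, show 1 - r ^ 2 = (1 - r) * (1 + r) by ring, mul_pow]
  field_simp

/-- The factor (1 + λ)^(d-1) of the density cancels against the cap measure, which is why the
threshold does not depend on λ. The scale c leaves room to shrink or enlarge the caps. -/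
theorem tendsto_radialDensity_mul_capMeasure {d : ℕ} (hd : 2 ≤ d) {lam : ℝ} (hlam : 0 ≤ lam)
    (γ : ℝ) {c : ℝ} (hc : 0 < c) :
    Tendsto (fun r => radialDensity d lam γ r * (capMeasure d (c * capRadius lam r)).toReal * (1 - r))
      (𝓝[<] 1) (𝓝 (γ * capConst d * c ^ (d - 1))) := by
  have h1 : Tendsto (fun r => c * capRadius lam r) (𝓝[<] 1) (𝓝[>] 0) := by
    refine tendsto_nhdsWithin_iff.2 ⟨by simpa using (tendsto_capRadius hlam).const_mul c, ?_⟩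
    filter_upwards [eventually_mem_Ioo_zero_one] with r hr
    exact mul_pos hc (capRadius_pos hlam hr)
  have h2 := ((tendsto_radialDensity_mul d (by omega) hlam γ).mul
    ((tendsto_capMeasure hd).comp h1)).mul (((tendsto_capRadius_div hlam).pow (d - 1)).const_mul
      (c ^ (d - 1)))
  have hval : γ * (1 + lam) ^ (d - 1) * capConst d * (c ^ (d - 1) * (1 / (1 + lam)) ^ (d - 1)) =
      γ * capConst d * c ^ (d - 1) := by
    have : 0 < (1 + lam) ^ (d - 1) := by positivity
    rw [div_pow, one_pow]
    field_simp
  rw [hval] at h2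
  refine h2.congr' ?_
  filter_upwards [eventually_mem_Ioo_zero_one] with r hr
  have h3 : 0 < 1 - r := sub_pos.2 hr.2
  have h4 := capRadius_pos hlam hr
  obtain ⟨n, rfl⟩ := Nat.exists_eq_add_of_le' (show 1 ≤ d by omega)
  simp only [Function.comp_apply, add_tsub_cancel_right, mul_pow, div_pow, pow_succ]
  field_simp

theorem lintegral_radialIntensity (d : ℕ) (lam γ : ℝ) {s : Set ℝ} (hs : MeasurableSet s)
    {F : ℝ → ℝ≥0∞} (hF : Measurable F) :
    ∫⁻ r in s, F r ∂(radialIntensity d lam γ) =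
      ∫⁻ r in s ∩ Ioo 0 1, ENNReal.ofReal (radialDensity d lam γ r) * F r := by
  have hm : Measurable fun r => ENNReal.ofReal (radialDensity d lam γ r) := by
    unfold radialDensity; fun_prop
  rw [radialIntensity, restrict_withDensity hs, lintegral_withDensity_eq_lintegral_mul _ hm hF,
    Measure.restrict_restrict hs]
  rfl

instance sfinite_radialIntensity (d : ℕ) (lam γ : ℝ) : SFinite (radialIntensity d lam γ) := by
  unfold radialIntensity; infer_instance

theorem radialDensity_nonneg (d : ℕ) {lam γ r : ℝ} (hlam : 0 ≤ lam) (hγ : 0 ≤ γ)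
    (hr : r ∈ Ioo (0 : ℝ) 1) : 0 ≤ radialDensity d lam γ r := by
  have h0 := hr.1
  have h1 : 0 ≤ 1 - r ^ 2 := by nlinarith [hr.1, hr.2]
  unfold radialDensity
  positivity

theorem radialIntensity_Ioo_ne_top (d : ℕ) {lam γ : ℝ} (hlam : lam ∈ Icc (0 : ℝ) 1) (hγ : 0 ≤ γ)
    {b : ℝ} (hb : b < 1) : radialIntensity d lam γ (Ioo 0 b) ≠ ⊤ := by
  have h1 := lintegral_radialIntensity d lam γ (measurableSet_Ioo (a := (0 : ℝ)) (b := b))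
    (F := fun _ => 1) measurable_const
  rw [setLIntegral_one] at h1
  rw [h1]
  refine ((lintegral_mono_set inter_subset_left).trans (setLIntegral_mono measurable_const
    (g := fun _ => ENNReal.ofReal (2 * γ * 4 ^ (d - 1) / (1 - b ^ 2) ^ d)) fun r hr => ?_)).trans_lt
    ?_ |>.ne
  · rw [mul_one]
    refine ENNReal.ofReal_le_ofReal ?_
    have h0 := hr.1
    have h2 := hr.2
    have h3 := hlam.1
    have h4 : 0 < 1 - b ^ 2 := by nlinarith
    have h5 : 1 - b ^ 2 ≤ 1 - r ^ 2 := by nlinarith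
    unfold radialDensity
    gcongr
    nlinarith [hlam.2]
  · rw [setLIntegral_const, Real.volume_Ioo]
    exact ENNReal.mul_lt_top ENNReal.ofReal_lt_top ENNReal.ofReal_lt_top

theorem setLIntegral_div_one_sub {α a b : ℝ} (hα : 0 ≤ α) (hab : a ≤ b) (hb : b < 1) :
    ∫⁻ r in Ioo a b, ENNReal.ofReal (α / (1 - r)) =
      ENNReal.ofReal (α * Real.log ((1 - a) / (1 - b))) := by
  have hcont : ContinuousOn (fun r : ℝ => α / (1 - r)) (uIcc a b) := by
    refine continuousOn_const.div (by fun_prop) fun r hr => ?_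
    rw [uIcc_of_le hab] at hr
    linarith [hr.2]
  rw [Measure.restrict_congr_set Ioo_ae_eq_Ioc,
    ← ofReal_integral_eq_lintegral_ofReal hcont.intervalIntegrable.1,
    ← intervalIntegral.integral_of_le hab]
  · congr 1
    simp_rw [div_eq_mul_inv α]
    rw [intervalIntegral.integral_const_mul,
      intervalIntegral.integral_comp_sub_left (fun x => x⁻¹) 1,
      integral_inv_of_pos (by linarith) (by linarith)]
  · filter_upwards [ae_restrict_mem measurableSet_Ioc] with r hr
    exact div_nonneg hα (by linarith [hr.2])

/-! ### The supercritical and the subcritical regime -/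

theorem eventually_lt_exists_Ioo {p : ℝ → Prop} (h : ∀ᶠ r in 𝓝[<] (1 : ℝ), p r) :
    ∃ a₀ ∈ Ioo (0 : ℝ) 1, ∀ r ∈ Ioo a₀ 1, p r := by
  obtain ⟨l, hl, hs⟩ := mem_nhdsLT_iff_exists_Ioo_subset.1 h
  have hl : l < 1 := hl
  refine ⟨max l (1 / 2), ⟨lt_max_of_lt_right (by norm_num), max_lt hl (by norm_num)⟩, fun r hr => ?_⟩
  exact hs ⟨(le_max_left _ _).trans_lt hr.1, hr.2⟩

/-- The strict inequality for γ leaves room for radii shrunk by a factor c < 1 while the hitting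
rate keeps a coefficient α above d - 1. -/
theorem exists_supercritical_bounds {d : ℕ} (hd : 2 ≤ d) {lam γ : ℝ} (hlam : 0 ≤ lam)
    (hγ : gammaCrit d < γ) :
    ∃ c α κ a₀ : ℝ, 0 < c ∧ c < 1 ∧ (d : ℝ) - 1 < α ∧ 0 < κ ∧ a₀ ∈ Ioo (0 : ℝ) 1 ∧
      ∀ r ∈ Ioo a₀ 1, κ * (1 - r) ≤ capRadius lam r ∧
        α / (1 - r) ≤ radialDensity d lam γ r * (capMeasure d (c * capRadius lam r)).toReal := by
  have hv := capConst_pos hd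
  have h1 : (d : ℝ) - 1 < γ * capConst d := by
    rw [← gammaCrit_mul_capConst hd]; gcongr
  have hcont : Continuous fun c : ℝ => γ * capConst d * c ^ (d - 1) := by fun_prop
  have h2 : ∀ᶠ c in 𝓝[<] (1 : ℝ), (d : ℝ) - 1 < γ * capConst d * c ^ (d - 1) :=
    ((hcont.tendsto 1).mono_left nhdsWithin_le_nhds).eventually_const_lt (by simpa using h1)
  obtain ⟨c, hc, hc0, hc1⟩ := (h2.and eventually_mem_Ioo_zero_one).exists
  obtain ⟨α, hα, hα1⟩ := exists_between hc
  have h3 := (tendsto_radialDensity_mul_capMeasure hd hlam γ hc0).eventually_const_le hα1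
  have hl : (0 : ℝ) < 1 / (1 + lam) := by positivity
  have h4 := (tendsto_capRadius_div hlam).eventually_const_le (half_lt_self hl)
  obtain ⟨a₀, ha₀, h⟩ := eventually_lt_exists_Ioo (h3.and h4)
  refine ⟨c, α, 1 / (1 + lam) / 2, a₀, hc0, hc1, hα, by positivity, ha₀, fun r hr => ?_⟩
  have hr1 : 0 < 1 - r := sub_pos.2 hr.2
  obtain ⟨h5, h6⟩ := h r hr
  rw [le_div_iff₀ hr1] at h6
  refine ⟨h6, ?_⟩
  rwa [div_le_iff₀ hr1]

theorem exists_subcritical_bounds {d : ℕ} (hd : 2 ≤ d) {lam γ : ℝ} (hlam : 0 ≤ lam) (hγ0 : 0 < γ)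
    (hγ : γ < gammaCrit d) :
    ∃ c α K a₀ : ℝ, 1 < c ∧ 0 < α ∧ α < (d : ℝ) - 1 ∧ 0 < K ∧ a₀ ∈ Ioo (0 : ℝ) 1 ∧
      ∀ r ∈ Ioo a₀ 1, capRadius lam r ≤ K * (1 - r) ∧
        radialDensity d lam γ r * (capMeasure d (c * capRadius lam r)).toReal ≤ α / (1 - r) := by
  have hv := capConst_pos hd
  have h1 : γ * capConst d < (d : ℝ) - 1 := by
    rw [← gammaCrit_mul_capConst hd]; gcongr
  have hcont : Continuous fun c : ℝ => γ * capConst d * c ^ (d - 1) := by fun_prop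
  have h2 : ∀ᶠ c in 𝓝[>] (1 : ℝ), γ * capConst d * c ^ (d - 1) < (d : ℝ) - 1 :=
    ((hcont.tendsto 1).mono_left nhdsWithin_le_nhds).eventually_lt_const (by simpa using h1)
  obtain ⟨c, hc, hc1⟩ := (h2.and self_mem_nhdsWithin).exists
  have hc1 : 1 < c := hc1
  have hc0 : 0 < c := by linarith
  obtain ⟨α, hα, hα1⟩ := exists_between hc
  have h3 := (tendsto_radialDensity_mul_capMeasure hd hlam γ hc0).eventually_le_const hα
  have h4 := (tendsto_capRadius_div hlam).eventually_le_const (lt_add_one _)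
  obtain ⟨a₀, ha₀, h⟩ := eventually_lt_exists_Ioo (h3.and h4)
  refine ⟨c, α, 1 / (1 + lam) + 1, a₀, hc1, lt_trans (by positivity) hα, hα1, by positivity, ha₀,
    fun r hr => ?_⟩
  have hr1 : 0 < 1 - r := sub_pos.2 hr.2
  obtain ⟨h5, h6⟩ := h r hr
  rw [div_le_iff₀ hr1] at h6
  refine ⟨h6, ?_⟩
  rwa [le_div_iff₀ hr1]

section Coverage

variable {Ω : Type*} [MeasurableSpace Ω] {P : Measure Ω} [IsProbabilityMeasure P] {d : ℕ}
  {u : ℕ → Ω → USphere d} {r : ℕ → Ω → ℝ} {lam γ : ℝ}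

/-- In the supercritical regime the caps with distance at least `a` cover the sphere. -/
theorem IsCapProcess.measure_uncovered_eq_zero (hd : 2 ≤ d) (hlam : lam ∈ Icc (0 : ℝ) 1)
    (hγ0 : 0 < γ) (hγ : gammaCrit d < γ) (h : IsCapProcess u r (radialIntensity d lam γ) P) :
    ∃ a₀ ∈ Ioo (0 : ℝ) 1, ∀ a ∈ Ico a₀ 1,
      P {ω | ∃ x : USphere d, ∀ n, r n ω ∈ Ioo a 1 → capRadius lam (r n ω) ≤ dist x (u n ω)} = 0 := by
  have hd1 : NeZero d := ⟨by omega⟩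
  obtain ⟨c, α, κ, a₀, hc0, hc1, hα, hκ, ha₀, hb⟩ := exists_supercritical_bounds hd hlam.1 hγ
  have hα0 : 0 < α := by
    have : (2 : ℝ) ≤ d := by exact_mod_cast hd
    linarith
  refine ⟨a₀, ha₀, fun a ha => ?_⟩
  set Q := {ω | ∃ x : USphere d, ∀ n, r n ω ∈ Ioo a 1 → capRadius lam (r n ω) ≤ dist x (u n ω)}
  set A := (1 - a) * κ * (1 - c) with hA
  have h1a : 0 < 1 - a := sub_pos.2 ha.2
  have h1c : 0 < 1 - c := sub_pos.2 hc1
  have hA0 : 0 < A := by positivity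
  have hεbound : ∀ ε ∈ Ioo (0 : ℝ) (min 1 A), P Q * capMeasure d ε ≤ ENNReal.ofReal ((ε / A) ^ α) := by
    intro ε hε
    have hε0 := hε.1
    have hε1 : ε < 1 := hε.2.trans_le (min_le_left _ _)
    have hεA : ε < A := hε.2.trans_le (min_le_right _ _)
    -- Chosen so that for distances below b the shrinkage (1 - c)·`capRadius` is at least ε;
    -- shrunken caps enlarged by ε then stay within the true ones.
    set b := 1 - ε / (κ * (1 - c)) with hbdef
    have hb1 : b < 1 := by
      have : 0 < ε / (κ * (1 - c)) := by positivity
      linarith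
    have hab : a ≤ b := by
      have : ε / (κ * (1 - c)) ≤ 1 - a := by
        rw [div_le_iff₀ (by positivity)]
        linarith
      linarith
    have hab' : Ioo a b ⊆ Ioo a₀ 1 := Ioo_subset_Ioo ha.1 hb1.le
    have hab0 : Ioo a b ⊆ Ioo 0 1 := Ioo_subset_Ioo (ha₀.1.le.trans ha.1) hb1.le
    classical
    -- The value -1 gives an empty cap, and it stays negative after adding ε < 1, so radii outside
    -- (a, b) impose no condition.
    set g : ℝ → ℝ := fun ρ => if ρ ∈ Ioo a b then c * capRadius lam ρ else -1 with hg
    have hgm : Measurable g :=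
      Measurable.ite measurableSet_Ioo ((measurable_capRadius lam).const_mul c) measurable_const
    have hsub : Q ⊆ {ω | ∃ x : USphere d, ∀ n, g (r n ω) + ε ≤ dist x (u n ω)} := by
      rintro ω ⟨x, hx⟩
      refine ⟨x, fun n => ?_⟩
      by_cases hn : r n ω ∈ Ioo a b
      · simp only [hg, if_pos hn]
        refine le_trans ?_ (hx n ⟨hn.1, hn.2.trans hb1⟩)
        have h2 := (hb _ (hab' hn)).1
        have h3 : ε / (κ * (1 - c)) ≤ 1 - r n ω := by linarith [hn.2]
        rw [div_le_iff₀ (by positivity)] at h3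
        nlinarith
      · simp only [hg, if_neg hn]
        linarith [dist_nonneg (x := x) (y := u n ω)]
    have hμ : radialIntensity d lam γ (Ioo a b) ≠ ⊤ := measure_ne_top_of_subset
      (Ioo_subset_Ioo_left (ha₀.1.le.trans ha.1)) (radialIntensity_Ioo_ne_top d hlam hγ0.le hb1)
    have hmain := h.measure_uncovered_nonempty_mul_le (by omega) hgm measurableSet_Ioo hμ
      (fun ρ hρ => by simp only [hg, if_neg hρ]; norm_num) ε
    refine (mul_le_mul_left (measure_mono hsub) _).trans (hmain.trans ?_)
    refine ENNReal.ofReal_le_ofReal ?_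
    have hlog : α * Real.log (A / ε) ≤
        (∫⁻ ρ, capMeasure d (g ρ) ∂(radialIntensity d lam γ)).toReal := by
      refine (ENNReal.ofReal_le_iff_le_toReal ?_).1 ?_
      · have : ∀ ρ, capMeasure d (g ρ) ≤ (Ioo a b).indicator 1 ρ := by
          intro ρ
          by_cases hρ : ρ ∈ Ioo a b
          · rw [indicator_of_mem hρ]; exact capMeasure_le_one d _
          · simp only [hg, if_neg hρ, indicator_of_notMem hρ]
            exact (capMeasure_of_nonpos d (by norm_num)).le
        refine ((lintegral_mono this).trans_lt ?_).ne
        rw [lintegral_indicator_one measurableSet_Ioo]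
        exact hμ.lt_top
      · have hAε : A / ε = (1 - a) / (1 - b) := by
          rw [hbdef, hA, sub_sub_cancel]; field_simp
        rw [hAε, ← setLIntegral_div_one_sub hα0.le hab hb1]
        calc ∫⁻ ρ in Ioo a b, ENNReal.ofReal (α / (1 - ρ))
            ≤ ∫⁻ ρ in Ioo a b ∩ Ioo 0 1, ENNReal.ofReal (radialDensity d lam γ ρ) *
                capMeasure d (g ρ) := by
              rw [inter_eq_left.2 hab0]
              refine setLIntegral_mono' measurableSet_Ioo fun ρ hρ => ?_
              rw [← ENNReal.ofReal_toReal (capMeasure_ne_top d (g ρ)), ← ENNReal.ofReal_mul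
                (radialDensity_nonneg d hlam.1 hγ0.le (hab0 hρ))]
              refine ENNReal.ofReal_le_ofReal ?_
              simp only [hg, if_pos hρ]
              exact (hb ρ (hab' hρ)).2
          _ = ∫⁻ ρ in Ioo a b, capMeasure d (g ρ) ∂(radialIntensity d lam γ) :=
              (lintegral_radialIntensity d lam γ measurableSet_Ioo
                ((measurable_capMeasure d).comp hgm)).symm
          _ ≤ _ := setLIntegral_le_lintegral _ _
    rw [Real.rpow_def_of_pos (by positivity)]
    refine Real.exp_le_exp.2 ?_
    rw [← inv_div, Real.log_inv]
    linarith
  have hcap : ∀ᶠ ε in 𝓝[>] (0 : ℝ), capConst d / 2 ≤ (capMeasure d ε).toReal / ε ^ (d - 1) :=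
    (tendsto_capMeasure hd).eventually_const_le (half_lt_self (capConst_pos hd))
  have hv := capConst_pos hd
  -- The first moment is of order ε^α while an ε-ball has measure of order ε^(d-1); the quotient
  -- vanishes as α > d - 1.
  have hev : ∀ᶠ ε in 𝓝[>] (0 : ℝ), P.real Q ≤
      2 / capConst d * (1 / A) ^ α * ε ^ (α - ((d : ℝ) - 1)) := by
    filter_upwards [hcap, Ioo_mem_nhdsGT (lt_min one_pos hA0)] with ε h1 h2
    have hε0 := h2.1
    have h3 := ENNReal.toReal_mono ENNReal.ofReal_ne_top (hεbound ε h2)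
    rw [ENNReal.toReal_mul, ENNReal.toReal_ofReal (by positivity), ← measureReal_def] at h3
    rw [le_div_iff₀ (by positivity)] at h1
    have h4 : P.real Q * (capConst d / 2 * ε ^ (d - 1)) ≤ (ε / A) ^ α :=
      (mul_le_mul_of_nonneg_left h1 measureReal_nonneg).trans h3
    have h5 : ε ^ (α - ((d : ℝ) - 1)) = ε ^ α / ε ^ (d - 1) := by
      rw [Real.rpow_sub hε0, ← Real.rpow_natCast ε (d - 1), Nat.cast_sub (by omega), Nat.cast_one]
    rw [h5]
    rw [Real.div_rpow hε0.le hA0.le] at h4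
    rw [Real.div_rpow zero_le_one hA0.le, Real.one_rpow]
    calc P.real Q = P.real Q * (capConst d / 2 * ε ^ (d - 1)) / (capConst d / 2 * ε ^ (d - 1)) := by
          rw [mul_div_cancel_right₀ _ (by positivity)]
      _ ≤ ε ^ α / A ^ α / (capConst d / 2 * ε ^ (d - 1)) := by gcongr
      _ = _ := by field_simp
  have hlim : Tendsto (fun ε : ℝ => 2 / capConst d * (1 / A) ^ α * ε ^ (α - ((d : ℝ) - 1)))
      (𝓝[>] 0) (𝓝 0) := by
    have h1 : 0 < α - ((d : ℝ) - 1) := by linarith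
    have h2 := (Real.continuousAt_rpow_const (0 : ℝ) (α - ((d : ℝ) - 1)) (Or.inr h1.le)).tendsto
    rw [Real.zero_rpow h1.ne'] at h2
    simpa using (h2.mono_left nhdsWithin_le_nhds).const_mul (2 / capConst d * (1 / A) ^ α)
  have h0 : P.real Q ≤ 0 := ge_of_tendsto hlim hev
  exact (measureReal_eq_zero_iff).1 (le_antisymm h0 measureReal_nonneg)

open Classical in
/-- The radius function of slightly enlarged caps beyond distance `a`, equal to `M` up to `a`. -/
def enlargedRadius (lam c a M ρ : ℝ) : ℝ := if ρ ≤ a then M else c * capRadius lam ρ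

theorem measurable_enlargedRadius (lam c a M : ℝ) : Measurable (enlargedRadius lam c a M) :=
  Measurable.ite measurableSet_Iic measurable_const ((measurable_capRadius lam).const_mul c)

theorem radialIntensity_Iic_ne_top (d : ℕ) (hlam : lam ∈ Icc (0 : ℝ) 1) (hγ : 0 ≤ γ)
    {a : ℝ} (ha : a < 1) : radialIntensity d lam γ (Iic a) ≠ ⊤ := by
  obtain ⟨b, hab, hb⟩ := exists_between ha
  have h : ∀ s, MeasurableSet s → radialIntensity d lam γ s =
      ∫⁻ r in s ∩ Ioo 0 1, ENNReal.ofReal (radialDensity d lam γ r) * 1 := fun s hs => by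
    rw [← lintegral_radialIntensity d lam γ hs measurable_const, setLIntegral_one]
  refine ((?_ : _ ≤ radialIntensity d lam γ (Ioo 0 b)).trans_lt
    (radialIntensity_Ioo_ne_top d hlam hγ hb).lt_top).ne
  rw [h _ measurableSet_Iic, h _ measurableSet_Ioo]
  exact lintegral_mono_set fun ρ hρ => ⟨⟨hρ.2.1, (show ρ ≤ a from hρ.1).trans_lt hab⟩, hρ.2⟩

theorem exp_mul_max_log_le {α B t : ℝ} (hB : 0 < B) (ht : 0 ≤ t) :
    Real.exp (α * max 0 (Real.log (B / t))) ≤ 1 + B ^ α * t ^ (-α) := by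
  have h1 : 0 ≤ B ^ α * t ^ (-α) := by positivity
  rcases le_total (Real.log (B / t)) 0 with h | h
  · rw [max_eq_left h, mul_zero, Real.exp_zero]; linarith
  · rw [max_eq_right h]
    rcases ht.eq_or_lt with rfl | ht
    -- At t = 0 the conventions B / 0 = 0 and log 0 = 0 make the left side equal to 1.
    · simp only [div_zero, Real.log_zero, mul_zero, Real.exp_zero]; linarith
    · rw [mul_comm α, ← Real.rpow_def_of_pos (by positivity), Real.div_rpow hB.le ht.le,
        Real.rpow_neg ht.le, div_eq_mul_inv]
      linarith

/-- Up to a, the cap measure is at most M: it is 0 when M = 0, and at most 1 ≤ M otherwise. Beyond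
a, the condition t < 2cK(1 - ρ) cuts the range off at some b < 1, and integrating α/(1 - ρ) up to b
gives the logarithm. -/
theorem setLIntegral_capMeasure_enlargedRadius_le (hd : 1 ≤ d) (hlam : lam ∈ Icc (0 : ℝ) 1)
    (hγ0 : 0 ≤ γ) {c α K a M : ℝ} (hc : 0 < c) (hα : 0 ≤ α) (hK : 0 < K) (ha : a ∈ Ioo (0 : ℝ) 1)
    (hb : ∀ r ∈ Ioo a 1, capRadius lam r ≤ K * (1 - r) ∧
        radialDensity d lam γ r * (capMeasure d (c * capRadius lam r)).toReal ≤ α / (1 - r))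
    (hM : M = 0 ∨ 1 ≤ M) {t : ℝ} (ht : 0 < t) :
    ∫⁻ ρ in {ρ | t < 2 * enlargedRadius lam c a M ρ}, capMeasure d (enlargedRadius lam c a M ρ)
      ∂(radialIntensity d lam γ) ≤
    ENNReal.ofReal (M * (radialIntensity d lam γ (Iic a)).toReal +
      α * max 0 (Real.log (2 * c * K * (1 - a) / t))) := by
  have hd1 : NeZero d := ⟨by omega⟩
  set g := enlargedRadius lam c a M with hg
  have hgm : Measurable g := measurable_enlargedRadius lam c a M
  have hga : ∀ ρ, ρ ≤ a → g ρ = M := fun ρ hρ => if_pos hρ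
  have hga' : ∀ ρ, a < ρ → g ρ = c * capRadius lam ρ := fun ρ hρ => if_neg (not_le.2 hρ)
  have hM0 : 0 ≤ M := by rcases hM with h | h <;> linarith
  have htop := radialIntensity_Iic_ne_top d hlam hγ0 ha.2
  have hsm : MeasurableSet {ρ | t < 2 * g ρ} := measurableSet_lt measurable_const (hgm.const_mul 2)
  have hsub : {ρ | t < 2 * g ρ} ⊆ Iic a ∪ ({ρ | t < 2 * g ρ} ∩ Ioi a) := fun ρ hρ => by
    rcases le_or_gt ρ a with h | h
    · exact Or.inl h
    · exact Or.inr ⟨hρ, h⟩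
  rw [ENNReal.ofReal_add (by positivity) (by positivity)]
  refine ((lintegral_mono_set hsub).trans (lintegral_union_le _ _ _)).trans (add_le_add ?_ ?_)
  · rw [setLIntegral_congr_fun (g := fun _ => capMeasure d M) measurableSet_Iic
      fun ρ hρ => by simp only [hga ρ hρ], setLIntegral_const]
    rcases hM with h | h
    · simp [h, capMeasure_of_nonpos d le_rfl]
    · rw [ENNReal.ofReal_mul hM0, ENNReal.ofReal_toReal htop]
      gcongr
      refine (capMeasure_le_one d M).trans ?_
      rwa [← ENNReal.ofReal_one, ENNReal.ofReal_le_ofReal_iff hM0]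
  · rw [lintegral_radialIntensity d lam γ (hsm.inter measurableSet_Ioi)
      (F := fun ρ => capMeasure d (g ρ)) ((measurable_capMeasure d).comp hgm)]
    set b := 1 - t / (2 * c * K) with hbdef
    have hsub2 : ({ρ | t < 2 * g ρ} ∩ Ioi a) ∩ Ioo 0 1 ⊆ Ioo a b := by
      rintro ρ ⟨⟨h1, h2⟩, h3⟩
      have h1 : t < 2 * g ρ := h1
      have h2 : a < ρ := h2
      refine ⟨h2, ?_⟩
      rw [hga' ρ h2] at h1
      have h4 := (hb ρ ⟨h2, h3.2⟩).1
      have h5 : t / (2 * c * K) < 1 - ρ := by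
        rw [div_lt_iff₀ (by positivity)]
        nlinarith
      linarith
    have hb1 : b < 1 := by
      have : 0 < t / (2 * c * K) := by positivity
      linarith
    calc _ ≤ ∫⁻ ρ in Ioo a b, ENNReal.ofReal (radialDensity d lam γ ρ) * capMeasure d (g ρ) :=
          lintegral_mono_set hsub2
      _ ≤ ∫⁻ ρ in Ioo a b, ENNReal.ofReal (α / (1 - ρ)) := by
          refine setLIntegral_mono' measurableSet_Ioo fun ρ hρ => ?_
          have hρ1 : ρ < 1 := hρ.2.trans hb1
          rw [← ENNReal.ofReal_toReal (capMeasure_ne_top d (g ρ)), ← ENNReal.ofReal_mul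
            (radialDensity_nonneg d hlam.1 hγ0 ⟨ha.1.trans hρ.1, hρ1⟩)]
          refine ENNReal.ofReal_le_ofReal ?_
          rw [hga' ρ hρ.1]
          exact (hb ρ ⟨hρ.1, hρ1⟩).2
      _ ≤ _ := by
          rcases le_or_gt a b with hab | hab
          · rw [setLIntegral_div_one_sub hα hab hb1]
            refine ENNReal.ofReal_le_ofReal (mul_le_mul_of_nonneg_left ?_ hα)
            have : (1 - a) / (1 - b) = 2 * c * K * (1 - a) / t := by
              rw [hbdef, sub_sub_cancel]; field_simp
            rw [this]
            exact le_max_right _ _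
          · rw [Ioo_eq_empty (not_lt.2 hab.le)]
            simp

/-- In the subcritical regime, slightly enlarged caps beyond distance `a` leave some point
uncovered, with a probability that is close to `1` if `a` is close to `1` and `M = 0`. -/
theorem IsCapProcess.exists_subcritical (hd : 2 ≤ d) (hlam : lam ∈ Icc (0 : ℝ) 1)
    (hγ0 : 0 < γ) (hγ : γ < gammaCrit d) (h : IsCapProcess u r (radialIntensity d lam γ) P)
    (hr : ∀ᵐ ω ∂P, ∀ n, r n ω ∈ Ioo (0 : ℝ) 1) :
    ∃ c α a₀ D : ℝ, ∃ C : ℝ≥0∞, 1 < c ∧ 0 < α ∧ a₀ ∈ Ioo (0 : ℝ) 1 ∧ 0 < D ∧ C ≠ ⊤ ∧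
      ∀ a ∈ Ico a₀ 1, ∀ M : ℝ, M = 0 ∨ 1 ≤ M → ∃ A : Set Ω, MeasurableSet A ∧
        1 ≤ P A * (ENNReal.ofReal (Real.exp (M * (radialIntensity d lam γ (Iic a)).toReal)) *
          (1 + ENNReal.ofReal ((D * (1 - a)) ^ α) * C)) ∧
        ∀ᵐ ω ∂P, ω ∈ A → (uncovered u r (enlargedRadius lam c a M) ω).Nonempty := by
  have hd1 : NeZero d := ⟨by omega⟩
  obtain ⟨c, α, K, a₀, hc, hα, hα1, hK, ha₀, hb⟩ :=
    exists_subcritical_bounds hd hlam.1 hγ0 hγ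
  obtain ⟨C, hC, hCb⟩ := exists_riesz_bound hd hα hα1
  refine ⟨c, α, a₀, 2 * c * K, C, hc, hα, ha₀, by positivity, hC, fun a ha M hM => ?_⟩
  have hM0 : 0 ≤ M := by rcases hM with h | h <;> linarith
  have ha0 : 0 < a := ha₀.1.trans_le ha.1
  have h1a : 0 < 1 - a := sub_pos.2 ha.2
  set m := (radialIntensity d lam γ (Iic a)).toReal with hm
  have hm0 : 0 ≤ m := ENNReal.toReal_nonneg
  set B := 2 * c * K * (1 - a) with hB
  have hB0 : 0 < B := by positivity
  refine h.exists_one_le_measure_mul_uncovered_nonempty (by omega) hr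
    (fun b hb => radialIntensity_Ioo_ne_top d hlam hγ0.le hb) (measurable_enlargedRadius lam c a M)
    (fun ρ => ?_) (F := fun t => M * m + α * max 0 (Real.log (B / t))) (fun t => by positivity)
    (fun t ht => setLIntegral_capMeasure_enlargedRadius_le (by omega) hlam hγ0.le (by positivity) hα.le
      hK ⟨ha0, ha.2⟩ (fun ρ hρ => hb ρ ⟨ha.1.trans_lt hρ.1, hρ.2⟩) hM ht) ?_
    (fun x => uniformSphere_singleton hd x) (fun x => ?_)
  · unfold enlargedRadius
    split_ifs
    · exact hM0
    · exact mul_nonneg (by positivity) (capRadius_nonneg _ _)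
  · exact ENNReal.mul_ne_top ENNReal.ofReal_ne_top
      (ENNReal.add_ne_top.2 ⟨ENNReal.one_ne_top, ENNReal.mul_ne_top ENNReal.ofReal_ne_top hC⟩)
  -- Exponentiating the logarithm gives a Riesz kernel of order α < d - 1, whose integral is bounded
  -- uniformly in x.
  · calc _ ≤ ∫⁻ y, ENNReal.ofReal (Real.exp (M * m)) * (1 + ENNReal.ofReal (B ^ α) *
          ENNReal.ofReal (dist x y ^ (-α))) ∂(uniformSphere d) := by
          refine lintegral_mono fun y => ?_
          rw [← ENNReal.ofReal_mul (by positivity), ← ENNReal.ofReal_one,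
            ← ENNReal.ofReal_add zero_le_one (by positivity), ← ENNReal.ofReal_mul (by positivity),
            Real.exp_add]
          refine ENNReal.ofReal_le_ofReal ?_
          gcongr
          exact exp_mul_max_log_le hB0 dist_nonneg
      _ = ENNReal.ofReal (Real.exp (M * m)) * (1 + ENNReal.ofReal (B ^ α) *
          ∫⁻ y, ENNReal.ofReal (dist x y ^ (-α)) ∂(uniformSphere d)) := by
          rw [lintegral_const_mul' _ _ ENNReal.ofReal_ne_top, lintegral_add_left measurable_const,
            lintegral_const_mul' _ _ ENNReal.ofReal_ne_top, lintegral_const, measure_univ, one_mul]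
      _ ≤ _ := by gcongr; exact hCb x

end Coverage

/-! ### Shadows of the hyperplanes and the visibility set -/

theorem lambdaRadius_pos {lam r : ℝ} (hlam : 0 ≤ lam) (hr : r ∈ Ioo (0 : ℝ) 1) :
    0 < lambdaRadius lam r := by
  have h0 := hr.1
  have h1 : 0 < 1 - r ^ 2 := by nlinarith [hr.1, hr.2]
  unfold lambdaRadius
  positivity

/-- The right side is the tangent length from the centre to the sphere, so φ(r) is the cosine of the
half-angle of the tangent cone. -/
theorem shadowHeight_mul {lam r : ℝ} (hlam : 0 ≤ lam) (hr : r ∈ Ioo (0 : ℝ) 1) :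
    shadowHeight lam r * (r + lambdaRadius lam r) = √(r ^ 2 + 2 * r * lambdaRadius lam r) := by
  have h0 := hr.1
  have hD : 0 < 1 + 2 * lam * r + r ^ 2 := by positivity
  have h1 : r + lambdaRadius lam r = (1 + 2 * lam * r + r ^ 2) / (2 * (lam + r)) := by
    unfold lambdaRadius; field_simp; ring
  have h2 : r ^ 2 + 2 * r * lambdaRadius lam r =
      r * (lam + r) * (1 + lam * r) / (lam + r) ^ 2 := by
    unfold lambdaRadius; field_simp; ring
  rw [h1, h2, Real.sqrt_div (by positivity), Real.sqrt_sq (by positivity)]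
  unfold shadowHeight
  field_simp

/-- The tangent points lie in the closed unit ball, so a ray in the open cap enters the sphere
before leaving the model. The inequality reduces to λ(1 - r²) ≥ 0. -/
theorem tangentLength_le_one {lam r : ℝ} (hlam : lam ∈ Icc (0 : ℝ) 1) (hr : r ∈ Ioo (0 : ℝ) 1) :
    √(r ^ 2 + 2 * r * lambdaRadius lam r) ≤ 1 := by
  have h0 := hr.1
  have h1 := hr.2
  have h2 := hlam.1
  refine Real.sqrt_le_iff.2 ⟨zero_le_one, ?_⟩
  rw [one_pow]
  have : r ^ 2 + 2 * r * lambdaRadius lam r = r * (1 + lam * r) / (lam + r) := by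
    unfold lambdaRadius; field_simp; ring
  rw [this, div_le_one (by positivity)]
  nlinarith [hlam.2, mul_nonneg h2 (sub_nonneg.2 h1.le)]

theorem norm_smul_sub_sq {d : ℕ} (lam r t : ℝ) (v u : USphere d) :
    ‖t • (v : EuclideanSpace ℝ (Fin d)) -
      (r + lambdaRadius lam r) • (u : EuclideanSpace ℝ (Fin d))‖ ^ 2 =
    t ^ 2 - 2 * t * ((r + lambdaRadius lam r) *
      ⟪(v : EuclideanSpace ℝ (Fin d)), (u : EuclideanSpace ℝ (Fin d))⟫) +
      (r + lambdaRadius lam r) ^ 2 := by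
  rw [norm_sub_sq_real, real_inner_smul_left, real_inner_smul_right, norm_smul, norm_smul]
  simp only [norm_eq_of_mem_sphere, mul_one, Real.norm_eq_abs, sq_abs]
  ring

theorem exists_norm_lt_of_mem_openCap {d : ℕ} {lam r : ℝ} (hlam : lam ∈ Icc (0 : ℝ) 1)
    (hr : r ∈ Ioo (0 : ℝ) 1) {v u : USphere d} (hv : v ∈ openCap u (shadowHeight lam r)) :
    ∃ t ∈ Ioo (0 : ℝ) 1, ‖t • (v : EuclideanSpace ℝ (Fin d)) -
      (r + lambdaRadius lam r) • (u : EuclideanSpace ℝ (Fin d))‖ < lambdaRadius lam r := by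
  have hR := lambdaRadius_pos hlam.1 hr
  have h0 := hr.1
  have hv : shadowHeight lam r < ⟪(v : EuclideanSpace ℝ (Fin d)), (u : EuclideanSpace ℝ (Fin d))⟫ := hv
  set s := ⟪(v : EuclideanSpace ℝ (Fin d)), (u : EuclideanSpace ℝ (Fin d))⟫ with hs
  set R := lambdaRadius lam r with hRdef
  set L := √(r ^ 2 + 2 * r * R) with hL
  have hL0 : 0 < L := Real.sqrt_pos.2 (by positivity)
  have hLsq : L ^ 2 = r ^ 2 + 2 * r * R := Real.sq_sqrt (by positivity)
  have hLs : L < (r + R) * s := by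
    rw [hL, ← shadowHeight_mul hlam.1 hr, mul_comm]
    gcongr
  have hcont : Continuous fun t : ℝ => t ^ 2 - 2 * t * ((r + R) * s) + L ^ 2 := by fun_prop
  have hneg : L ^ 2 - 2 * L * ((r + R) * s) + L ^ 2 < 0 := by nlinarith
  -- The quadratic is already negative at L, but L may equal 1; moving slightly to the left secures
  -- t < 1.
  have hev := ((hcont.tendsto L).mono_left (nhdsWithin_le_nhds (s := Iio L))).eventually_lt_const hneg
  obtain ⟨t, ht, ht0, htL⟩ := (hev.and (Ioo_mem_nhdsLT hL0)).exists
  refine ⟨t, ⟨ht0, htL.trans_le (tangentLength_le_one hlam hr)⟩, ?_⟩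
  refine lt_of_pow_lt_pow_left₀ 2 hR.le ?_
  rw [norm_smul_sub_sq]
  nlinarith

/-- Intermediate values: the ray starts outside the sphere, at distance r + R from its centre, and
is inside it at parameter t. -/
theorem exists_mem_segment_of_norm_lt {d : ℕ} {lam r : ℝ} (hr : 0 < r)
    (hR : 0 < lambdaRadius lam r) {v u : USphere d} {t ρ : ℝ} (ht : t ∈ Ioo (0 : ℝ) 1) (htρ : t ≤ ρ)
    (h : ‖t • (v : EuclideanSpace ℝ (Fin d)) -
      (r + lambdaRadius lam r) • (u : EuclideanSpace ℝ (Fin d))‖ < lambdaRadius lam r) :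
    (segment ℝ 0 (ρ • (v : EuclideanSpace ℝ (Fin d))) ∩ lambdaHyperplane lam r u).Nonempty := by
  set w := (r + lambdaRadius lam r) • (u : EuclideanSpace ℝ (Fin d)) with hw
  have hcont : ContinuousOn (fun τ : ℝ => ‖τ • (v : EuclideanSpace ℝ (Fin d)) - w‖) (Icc 0 t) := by
    fun_prop
  have hwn : ‖w‖ = r + lambdaRadius lam r := by
    rw [hw, norm_smul, norm_eq_of_mem_sphere, mul_one, Real.norm_of_nonneg (by linarith)]
  have hmem : lambdaRadius lam r ∈ Icc ‖t • (v : EuclideanSpace ℝ (Fin d)) - w‖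
      ‖(0 : ℝ) • (v : EuclideanSpace ℝ (Fin d)) - w‖ := by
    refine ⟨h.le, ?_⟩
    rw [zero_smul, zero_sub, norm_neg, hwn]
    linarith
  obtain ⟨τ, hτ, hτR⟩ := intermediate_value_Icc' ht.1.le hcont hmem
  refine ⟨τ • (v : EuclideanSpace ℝ (Fin d)), ?_, ?_, ?_⟩
  · have hρ : 0 < ρ := ht.1.trans_le htρ
    rw [segment_eq_image']
    refine ⟨τ / ρ, ⟨div_nonneg hτ.1 hρ.le, (div_le_one hρ).2 (hτ.2.trans htρ)⟩, ?_⟩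
    simp only [sub_zero, zero_add, smul_smul, div_mul_cancel₀ _ hρ.ne']
  · simpa [lambdaSphere, dist_eq_norm] using hτR
  · rw [mem_ball_zero_iff, norm_smul, norm_eq_of_mem_sphere, mul_one, Real.norm_of_nonneg hτ.1]
    exact hτ.2.trans_lt ht.2

theorem segment_inter_eq_empty {d : ℕ} {lam r : ℝ} (hlam : 0 ≤ lam) (hr : r ∈ Ioo (0 : ℝ) 1)
    {v u : USphere d} (hv : v ∉ closedCap u (shadowHeight lam r)) {ρ : ℝ} (hρ : 0 ≤ ρ) :
    segment ℝ 0 (ρ • (v : EuclideanSpace ℝ (Fin d))) ∩ lambdaHyperplane lam r u = ∅ := by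
  have hR := lambdaRadius_pos hlam hr
  have h0 := hr.1
  have hv : ⟪(v : EuclideanSpace ℝ (Fin d)), (u : EuclideanSpace ℝ (Fin d))⟫ < shadowHeight lam r :=
    not_le.1 hv
  rw [eq_empty_iff_forall_notMem]
  rintro x ⟨hx, hS, -⟩
  rw [segment_eq_image'] at hx
  obtain ⟨θ, hθ, rfl⟩ := hx
  simp only [sub_zero, zero_add, smul_smul] at hS
  have hS : ‖(θ * ρ) • (v : EuclideanSpace ℝ (Fin d)) -
      (r + lambdaRadius lam r) • (u : EuclideanSpace ℝ (Fin d))‖ = lambdaRadius lam r := by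
    simpa [lambdaSphere, dist_eq_norm] using hS
  have hq := norm_smul_sub_sq lam r (θ * ρ) v u
  rw [hS] at hq
  have ht : 0 ≤ θ * ρ := mul_nonneg hθ.1 hρ
  set t := θ * ρ
  set s := ⟪(v : EuclideanSpace ℝ (Fin d)), (u : EuclideanSpace ℝ (Fin d))⟫ with hs
  set R := lambdaRadius lam r with hRdef
  set L := √(r ^ 2 + 2 * r * R) with hL
  have hL0 : 0 < L := Real.sqrt_pos.2 (by positivity)
  have hLsq : L ^ 2 = r ^ 2 + 2 * r * R := Real.sq_sqrt (by positivity)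
  have hLs : (r + R) * s < L := by
    rw [hL, ← shadowHeight_mul hlam hr, mul_comm]
    gcongr
  rcases ht.eq_or_lt with h | h
  · rw [← h] at hq
    nlinarith
  -- A point on the sphere would give t² + L² = 2t(r + R)s < 2tL, contradicting (t - L)² ≥ 0.
  · nlinarith [mul_lt_mul_of_pos_left hLs h, sq_nonneg (t - L)]

theorem poincareDist_zero_left {d : ℕ} (x : EuclideanSpace ℝ (Fin d)) :
    poincareDist 0 x = Real.arcosh (1 + 2 * ‖x‖ ^ 2 / (1 - ‖x‖ ^ 2)) := by
  simp [poincareDist]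

/-- Being strictly inside an obstacle's sphere at a fixed parameter `t v` is an open condition on
the direction. By compactness finitely many parameters below 1 bound the visible range in all
directions. -/
theorem hypBounded_visibilitySet {d : ℕ} {lam : ℝ} (hlam : lam ∈ Icc (0 : ℝ) 1)
    {u : ℕ → USphere d} {r : ℕ → ℝ} (hr : ∀ n, r n ∈ Ioo (0 : ℝ) 1)
    (hcov : ∀ v, ∃ n, v ∈ openCap (u n) (shadowHeight lam (r n))) :
    HypBounded (visibilitySet (range fun n => lambdaHyperplane lam (r n) (u n))) := by
  choose n hn using hcov
  choose t ht hlt using fun v => exists_norm_lt_of_mem_openCap hlam (hr (n v)) (hn v)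
  set U : USphere d → Set (USphere d) := fun v => {v' | ‖t v • (v' : EuclideanSpace ℝ (Fin d)) -
      (r (n v) + lambdaRadius lam (r (n v))) • (u (n v) : EuclideanSpace ℝ (Fin d))‖ <
      lambdaRadius lam (r (n v))}
  have hU : ∀ v ∈ (univ : Set (USphere d)), U v ∈ 𝓝 v := fun v _ =>
    (isOpen_lt (by fun_prop) continuous_const).mem_nhds (hlt v)
  obtain ⟨s, -, hs⟩ := isCompact_univ.elim_nhds_subcover U hU
  obtain ⟨C, hC⟩ := (s.image fun v => Real.arcosh (1 + 2 * t v ^ 2 / (1 - t v ^ 2))).exists_le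
  refine ⟨max C (Real.arcosh 1), fun x hx => ?_⟩
  rw [poincareDist_zero_left]
  rcases eq_or_ne x 0 with rfl | hx0
  · simp
  have hxn : 0 < ‖x‖ := norm_pos_iff.2 hx0
  have hv1 : ‖‖x‖⁻¹ • x‖ = 1 := by
    rw [norm_smul, norm_inv, norm_norm, inv_mul_cancel₀ hxn.ne']
  let v' : USphere d := ⟨‖x‖⁻¹ • x, by simpa using hv1⟩
  have hxv : ‖x‖ • (v' : EuclideanSpace ℝ (Fin d)) = x := by
    change ‖x‖ • (‖x‖⁻¹ • x) = x
    rw [smul_smul, mul_inv_cancel₀ hxn.ne', one_smul]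
  obtain ⟨v, hvs, hv⟩ := mem_iUnion₂.1 (hs (mem_univ v'))
  have hlt' : ‖x‖ < t v := by
    by_contra hcon
    have := exists_mem_segment_of_norm_lt (hr (n v)).1 (lambdaRadius_pos hlam.1 (hr (n v))) (ht v)
      (not_lt.1 hcon) hv
    rw [hxv, hx.2 _ ⟨n v, rfl⟩] at this
    exact not_nonempty_empty this
  refine le_max_of_le_left (le_trans ?_ (hC _ (Finset.mem_image_of_mem _ hvs)))
  have h1 := (ht v).2
  have h2 : 0 < 1 - t v ^ 2 := by nlinarith [(ht v).1]
  have h3 : 0 < 1 - ‖x‖ ^ 2 := by nlinarith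
  rw [Real.arcosh_le_arcosh (by positivity) (by positivity)]
  gcongr

theorem not_hypBounded_visibilitySet {d : ℕ} {lam : ℝ} (hlam : 0 ≤ lam)
    {u : ℕ → USphere d} {r : ℕ → ℝ} (hr : ∀ n, r n ∈ Ioo (0 : ℝ) 1)
    {v : USphere d} (hv : ∀ n, v ∉ closedCap (u n) (shadowHeight lam (r n))) :
    ¬ HypBounded (visibilitySet (range fun n => lambdaHyperplane lam (r n) (u n))) := by
  rintro ⟨C, hC⟩
  set Y := Real.cosh (|C| + 1) with hY
  have hY1 : 1 < Y := Real.one_lt_cosh.2 (by positivity)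
  -- Solves 1 + 2q/(1 - q) = Y, so the point with squared norm q has hyperbolic distance |C| + 1
  -- from the centre.
  set q := (Y - 1) / (Y + 1) with hq
  have hq0 : 0 ≤ q := div_nonneg (by linarith) (by linarith)
  have hq1 : q < 1 := by rw [hq, div_lt_one (by linarith)]; linarith
  have hn : ‖√q • (v : EuclideanSpace ℝ (Fin d))‖ = √q := by
    rw [norm_smul, norm_eq_of_mem_sphere, mul_one, Real.norm_of_nonneg (Real.sqrt_nonneg _)]
  have h := hC (√q • (v : EuclideanSpace ℝ (Fin d))) ⟨?_, ?_⟩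
  · rw [poincareDist_zero_left, hn, Real.sq_sqrt hq0] at h
    have : 1 + 2 * q / (1 - q) = Y := by
      have h1 : 1 - q = 2 / (Y + 1) := by rw [hq]; field_simp; ring
      rw [h1, hq]; field_simp; ring
    rw [this, hY, Real.arcosh_cosh (by positivity)] at h
    linarith [le_abs_self C]
  · rw [mem_ball_zero_iff, hn, Real.sqrt_lt' one_pos]
    simpa using hq1
  · rintro _ ⟨n, rfl⟩
    exact segment_inter_eq_empty hlam (hr n) (hv n) (Real.sqrt_nonneg _)

end

/-! ### The two regimes assembled -/

theorem theorem3p3 (d : ℕ) (hd : 2 ≤ d) (lam γ : ℝ) (hlam : lam ∈ Icc (0 : ℝ) 1) (hγ : 0 < γ)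
    {Ω : Type*} [MeasurableSpace Ω] (P : Measure Ω) [IsProbabilityMeasure P]
    (u : ℕ → Ω → USphere d) (r : ℕ → Ω → ℝ)
    (hu_meas : ∀ n, Measurable (u n))
    (hu_indep : iIndepFun u P)
    (hu_unif : ∀ n, HasLaw (u n) (uniformSphere d) P)
    (hr_poisson : IsPoissonPointProcess r (radialIntensity d lam γ) P)
    (hr_ordered : ∀ᵐ ω ∂P, (∀ n, r n ω ∈ Ioo (0 : ℝ) 1) ∧ StrictMono fun n => r n ω)
    (hur : IndepFun (fun ω n => u n ω) (fun ω n => r n ω) P) :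
    (gammaCrit d < γ →
      (∀ᵐ ω ∂P, limsup (fun n => openCap (u n ω) (shadowHeight lam (r n ω))) atTop = univ) ∧
      (∀ᵐ ω ∂P, HypBounded (visibilitySet
        (range fun n => lambdaHyperplane lam (r n ω) (u n ω))))) ∧
    (γ < gammaCrit d →
      P {ω | limsup (fun n => openCap (u n ω) (shadowHeight lam (r n ω))) atTop = univ} = 0 ∧
      0 < P {ω | (⋃ n, closedCap (u n ω) (shadowHeight lam (r n ω))) ≠ univ} ∧
      0 < P {ω | ¬ HypBounded (visibilitySet
        (range fun n => lambdaHyperplane lam (r n ω) (u n ω)))}) := by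
  have h : IsCapProcess u r (radialIntensity d lam γ) P :=
    ⟨hu_meas, hu_indep, hu_unif, hr_poisson, hur⟩
  have hr : ∀ᵐ ω ∂P, ∀ n, r n ω ∈ Ioo (0 : ℝ) 1 := hr_ordered.mono fun _ hω => hω.1
  refine ⟨fun hsup => ?_, fun hsub => ?_⟩
  · obtain ⟨a₀, ha₀, hnull⟩ := h.measure_uncovered_eq_zero hd hlam hγ hsup
    have hcov : ∀ᵐ ω ∂P, ∀ k : ℕ, ∀ x : USphere d, ∃ n,
        1 - (1 - a₀) / ((k : ℝ) + 1) < r n ω ∧ dist x (u n ω) < capRadius lam (r n ω) := by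
      refine ae_all_iff.2 fun k => ?_
      have h1 : 0 < 1 - a₀ := sub_pos.2 ha₀.2
      have hk : (1 - a₀) / ((k : ℝ) + 1) ≤ 1 - a₀ :=
        div_le_self h1.le (by linarith [Nat.cast_nonneg (α := ℝ) k])
      have hk0 : 0 < (1 - a₀) / ((k : ℝ) + 1) := by positivity
      have h2 := hnull (1 - (1 - a₀) / ((k : ℝ) + 1)) ⟨by linarith, by linarith⟩
      filter_upwards [measure_eq_zero_iff_ae_notMem.1 h2] with ω hω x
      by_contra hcon
      push Not at hcon
      exact hω ⟨x, fun n hn => hcon n hn.1⟩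
    have hlimsup : ∀ᵐ ω ∂P,
        limsup (fun n => openCap (u n ω) (shadowHeight lam (r n ω))) atTop = univ := by
      filter_upwards [hcov, hr] with ω hω hrω
      refine eq_univ_of_forall fun x => ?_
      rw [mem_limsup_iff_frequently_mem, frequently_atTop]
      intro N
      -- The first N radii lie below some threshold, so a covering cap beyond that threshold has
      -- index at least N.
      have hex : ∃ k : ℕ, ∀ n < N, r n ω < 1 - (1 - a₀) / ((k : ℝ) + 1) := by
        have hlim : Tendsto (fun k : ℕ => 1 - (1 - a₀) / ((k : ℝ) + 1)) atTop (nhds 1) := by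
          have := (tendsto_one_div_add_atTop_nhds_zero_nat (𝕜 := ℝ)).const_mul (1 - a₀)
          simpa [div_eq_mul_inv] using this.const_sub 1
        have : ∀ᶠ k : ℕ in atTop, ∀ n ∈ Finset.range N, r n ω < 1 - (1 - a₀) / ((k : ℝ) + 1) :=
          (Finset.eventually_all _).2 fun n _ => hlim.eventually_const_lt (hrω n).2
        obtain ⟨k, hk⟩ := this.exists
        exact ⟨k, fun n hn => hk n (Finset.mem_range.2 hn)⟩
      obtain ⟨k, hk⟩ := hex
      obtain ⟨n, hn1, hn2⟩ := hω k x
      refine ⟨n, ?_, (mem_openCap_iff hlam.1 (hrω n) x _).2 hn2⟩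
      by_contra hcon
      exact absurd hn1 (hk n (not_le.1 hcon)).not_gt
    refine ⟨hlimsup, ?_⟩
    filter_upwards [hlimsup, hr] with ω hω hrω
    refine hypBounded_visibilitySet hlam hrω fun v => ?_
    have hv : v ∈ limsup (fun n => openCap (u n ω) (shadowHeight lam (r n ω))) atTop := by
      rw [hω]; exact mem_univ v
    exact (mem_limsup_iff_frequently_mem.1 hv).exists
  · obtain ⟨c, α, a₀, D, C, hc, hα, ha₀, hD, hC, hA⟩ := h.exists_subcritical hd hlam hγ hsub hr
    have hlt : ∀ {ρ}, ρ ∈ Ioo (0 : ℝ) 1 → capRadius lam ρ < c * capRadius lam ρ := fun hρ => by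
      nlinarith [capRadius_pos hlam.1 hρ]
    have hpos : ∃ A : Set Ω, 0 < P A ∧ ∀ᵐ ω ∂P, ω ∈ A →
        ∃ v : USphere d, ∀ n, v ∉ closedCap (u n ω) (shadowHeight lam (r n ω)) := by
      -- The radius 3 exceeds the diameter 2 of the sphere, so an uncovered point can exist only if
      -- no obstacle has distance at most a₀. The factor c > 1 then keeps the point off the closed
      -- caps.
      obtain ⟨A, -, hA1, hA2⟩ := hA a₀ ⟨le_rfl, ha₀.2⟩ 3 (Or.inr (by norm_num))
      refine ⟨A, pos_iff_ne_zero.2 fun h0 => ?_, ?_⟩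
      · rw [h0, zero_mul] at hA1
        exact absurd hA1 (by simp)
      · filter_upwards [hA2, hr] with ω hω hrω hmem
        obtain ⟨x, hx⟩ := hω hmem
        refine ⟨x, fun n hn => ?_⟩
        rw [mem_closedCap_iff hlam.1 (hrω n)] at hn
        have hxn := hx n
        have hle : dist x (u n ω) ≤ 2 := by
          refine (dist_triangle_right (x : EuclideanSpace ℝ (Fin d)) (u n ω) 0).trans ?_
          simp only [dist_zero_right, norm_eq_of_mem_sphere]
          norm_num
        unfold enlargedRadius at hxn
        split_ifs at hxn
        · linarith
        · linarith [hlt (hrω n)]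
    refine ⟨?_, ?_, ?_⟩
    · have hbound : ∀ a ∈ Ico a₀ 1,
          P {ω | limsup (fun n => openCap (u n ω) (shadowHeight lam (r n ω))) atTop = univ} ≤
            ENNReal.ofReal ((D * (1 - a)) ^ α) * C := by
        intro a ha
        -- With M = 0 the obstacles up to a are ignored. Almost surely they are finitely many, so a
        -- point missed by all others lies in only finitely many caps.
        obtain ⟨A, hAm, hA1, hA2⟩ := hA a ha 0 (Or.inl rfl)
        rw [zero_mul, Real.exp_zero, ENNReal.ofReal_one, one_mul, mul_add, mul_one] at hA1
        have hfin := h.poisson.ae_finite measurableSet_Iic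
          (radialIntensity_Iic_ne_top d hlam hγ.le ha.2)
        calc _ ≤ P Aᶜ := by
              refine measure_mono_ae ?_
              filter_upwards [hA2, hr, hfin] with ω hω hrω hfinω hlim hmem
              obtain ⟨x, hx⟩ := hω hmem
              have hlim : limsup (fun n => openCap (u n ω) (shadowHeight lam (r n ω))) atTop =
                univ := hlim
              have hxm : x ∈ limsup (fun n => openCap (u n ω) (shadowHeight lam (r n ω))) atTop := by
                rw [hlim]; exact mem_univ x
              rw [mem_limsup_iff_frequently_mem, Nat.frequently_atTop_iff_infinite] at hxm
              refine hxm (hfinω.subset fun n hn => ?_)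
              have hn : x ∈ openCap (u n ω) (shadowHeight lam (r n ω)) := hn
              rw [mem_openCap_iff hlam.1 (hrω n)] at hn
              by_contra hcon
              have hxn := hx n
              rw [enlargedRadius, if_neg (by exact hcon)] at hxn
              linarith [hlt (hrω n)]
          _ = 1 - P A := prob_compl_eq_one_sub hAm
          _ ≤ _ := by
              rw [tsub_le_iff_left]
              refine hA1.trans (add_le_add le_rfl ?_)
              exact mul_le_of_le_one_left zero_le prob_le_one
      have hlim : Tendsto (fun a : ℝ => ENNReal.ofReal ((D * (1 - a)) ^ α) * C)
          (nhdsWithin 1 (Iio 1)) (nhds 0) := by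
        have h1 : Continuous fun a : ℝ => (D * (1 - a)) ^ α :=
          (by fun_prop : Continuous fun a : ℝ => D * (1 - a)).rpow_const fun _ => Or.inr hα.le
        have h2 := ((ENNReal.continuous_ofReal.comp h1).tendsto 1).mono_left
          (nhdsWithin_le_nhds (s := Iio 1))
        simp only [Function.comp_apply, sub_self, mul_zero, Real.zero_rpow hα.ne',
          ENNReal.ofReal_zero] at h2
        simpa using ENNReal.Tendsto.mul_const h2 (Or.inr hC)
      refine le_antisymm (ge_of_tendsto hlim ?_) zero_le
      filter_upwards [Ioo_mem_nhdsLT ha₀.2] with a ha using hbound a ⟨ha.1.le, ha.2⟩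
    · obtain ⟨A, hA0, hA1⟩ := hpos
      refine hA0.trans_le (measure_mono_ae ?_)
      filter_upwards [hA1] with ω hω hmem heq
      obtain ⟨v, hv⟩ := hω hmem
      obtain ⟨n, hn⟩ := mem_iUnion.1 (heq ▸ mem_univ v :
        v ∈ ⋃ n, closedCap (u n ω) (shadowHeight lam (r n ω)))
      exact hv n hn
    · obtain ⟨A, hA0, hA1⟩ := hpos
      refine hA0.trans_le (measure_mono_ae ?_)
      filter_upwards [hA1, hr] with ω hω hrω hmem
      obtain ⟨v, hv⟩ := hω hmem
      exact not_hypBounded_visibilitySet hlam.1 hrω hv
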